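/- Conventions. A simplicial complex $X$ is a family of finite subsets (faces) of a vertex set, closed under inclusion and containing $\emptyset$; $\dim\sigma=|\sigma|-1$ and $X(k)$ is the set of $k$-dimensional faces. A $d$-complex is a finite pure $d$-dimensional simplicial complex. $C^k(X)$ is the space of functions $X(k)\to\mathbb F_2$ ($k\ge -1$), identified with subsets of $X(k)$; $(\delta f)(\tau)=\sum_{\sigma\subset\tau,\,|\sigma|=|\tau|-1}f(\sigma)$; $B^k=\delta(C^{k-1})$ and $Z^k=\ker(\delta|_{C^k})$. For a $d$-complex $X$ and $A\in C^k(X)$, $$\|A\|=\|A\|_X=\sum_{\sigma\in A}w(\sigma),\qquad w(\sigma)=\frac{|\{F\in X(d):\sigma\subset F\}|}{\binom{d+1}{|\sigma|}\,|X(d)|}.$$ Put $$Exp_b^k(X)=\min_{A\in C^k\setminus B^k}\frac{\|\delta A\|}{\min_{b\in B^k}\|A+b\|},\quad Exp_z^k(X)=\min_{A\in C^k\setminus Z^k}\frac{\|\delta A\|}{\min_{z\in Z^k}\|A+z\|},\quad Syst^k(X)=\min_{z\in Z^k\setminus B^k}\|z\|,$$ where a minimum over the empty set is $+\infty$. A $d$-complex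 $X$ is a $\beta$-coboundary expander if $Exp_b^k(X)\ge\beta$ for all $0\le k\le d-1$; it is an $(\epsilon,\mu)$-cosystolic expander if $Exp_z^k(X)\ge\epsilon$ and $Syst^k(X)\ge\mu$ for all $0\le k\le d-1$; it is an $\alpha$-skeleton expander if $\|E(A,A)\|\le 4(\|A\|^2+\alpha\|A\|)$ for all $A\subset X(0)$, where $E(A,A)\subset X(1)$ is the set of edges with both vertices in $A$. The link of $\sigma\in X$ is the $(d-|\sigma|)$-complex $X_\sigma=\{\tau\in X:\sigma\cap\tau=\emptyset,\ \sigma\cup\tau\in X\}$ (so $X_\emptyset=X$), and the $k$-skeleton $X^{(k)}$ is the $k$-complex of all faces of dimension at most $k$. Norms on links and skeletons are those of the link or skeleton as a complex in its own right. Theorem. For every $d\in\mathbb N$ and $\beta>0$ there exist $\mu=\mu(d,\beta)>0$ and $\alpha=\alpha(d,\beta)>0$, and for every $Q\in\mathbb N$ there exists $\epsilon=\epsilon(d,\beta,Q)>0$, such that the following holds for every $d$-complex $X$ satisfying: 1. $X$ is $Q$-bounded degree, i.e. $\max_{v\in X(0)}|X_v|\le Q$ (where $|X_v|$ is the number of faces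 of the link); 2. for every $\sigma\in X$ with $1\le|\sigma|\le d-1$, the link $X_\sigma$ is a $\beta$-coboundary expander; 3. for every $\sigma\in X$ with $0\le|\sigma|\le d-1$, the link $X_\sigma$ is an $\alpha$-skeleton expander. Then for all $0\le k\le d-2$ and all $0\le r\le d-1$, $$Exp_z^k(X)\ge\epsilon\qquad\text{and}\qquad Syst^r(X)\ge\mu .$$ Thus the $(d-1)$-skeleton of $X$ satisfies the inequalities defining an $(\epsilon,\mu)$-cosystolic expander when its cochains are measured in the norm of $X$; and, measured in its own norm, the $(d-1)$-skeleton of $X$ is an $(\epsilon,\mu/Q)$-cosystolic expander. -/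

import Mathlib

/-- A finite simplicial complex over the vertex set `V`: a finite family of finite subsets of `V`,
closed under inclusion.  The empty set is a face of every complex.  (Elements of `V` need not be
vertices of the complex.) -/
structure FinComplex (V : Type*) where
  faces : Finset (Finset V)
  empty_mem : ∅ ∈ faces
  down_closed : ∀ {s t : Finset V}, s ∈ faces → t ⊆ s → t ∈ faces

namespace FinComplex

variable {V : Type*}

/-- `dim X + 1`, i.e. the maximal number of vertices of a face. -/
def size (X : FinComplex V) : ℕ := X.faces.sup Finset.card

/-- `X` is a `d`-complex: finite, of dimension `d`, and pure (every face lies in a `d`-face). -/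
def IsDComplex (X : FinComplex V) (d : ℕ) : Prop :=
  X.size = d + 1 ∧ ∀ s ∈ X.faces, ∃ t ∈ X.faces, s ⊆ t ∧ t.card = d + 1

/-- The faces with `n` vertices, i.e. the faces of dimension `n - 1`. -/
def facesCard (X : FinComplex V) (n : ℕ) : Finset (Finset V) :=
  X.faces.filter (fun s => s.card = n)

/-- The type of faces with `n` vertices: this is `X(n - 1)`. -/
abbrev Face (X : FinComplex V) (n : ℕ) : Type _ := {s : Finset V // s ∈ X.facesCard n}

/-- The space `C^{n-1}(X; 𝔽₂)` of functions `X(n - 1) → 𝔽₂`.  Cochains are indexed by the number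
`n` of vertices, so that `n = 0` is the space of `(-1)`-cochains.  A set of faces is identified
with its indicator function. -/
abbrev Cochain (X : FinComplex V) (n : ℕ) : Type _ := X.Face n → ZMod 2

open scoped Classical in
/-- The coboundary map `δ^{n-1} : C^{n-1} → C^n`, `(δ f)(τ) = ∑_{σ ⊂ τ} f(σ)`. -/
noncomputable def cobd (X : FinComplex V) (n : ℕ) :
    X.Cochain n →ₗ[ZMod 2] X.Cochain (n + 1) where
  toFun f τ := ∑ σ : X.Face n with σ.1 ⊆ τ.1, f σ
  map_add' f g := by
    funext τ
    simp [Finset.sum_add_distrib]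
  map_smul' c f := by
    funext τ
    simp [Finset.mul_sum]

/-- The space `Z^k = ker δ^k` of `k`-cocycles. -/
noncomputable def cocycles (X : FinComplex V) (k : ℕ) : Submodule (ZMod 2) (X.Cochain (k + 1)) :=
  LinearMap.ker (X.cobd (k + 1))

/-- The space `B^k = im δ^{k-1}` of `k`-coboundaries, `k ≥ 0`; in particular `B^0` is the image of
the `(-1)`-cochains. -/
noncomputable def coboundaries (X : FinComplex V) (k : ℕ) :
    Submodule (ZMod 2) (X.Cochain (k + 1)) :=
  LinearMap.range (X.cobd k)

open scoped Classical in
/-- The weight `w(σ) = |{F ∈ X(d) | σ ⊆ F}| / (binom(d+1, |σ|) |X(d)|)`, where `d = dim X`. -/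
noncomputable def weight (X : FinComplex V) (σ : Finset V) : ℝ :=
  (((X.facesCard X.size).filter (fun F => σ ⊆ F)).card : ℝ) /
    ((X.size.choose σ.card : ℝ) * ((X.facesCard X.size).card : ℝ))

open scoped Classical in
/-- The norm `‖A‖ = ∑_{σ ∈ A} w(σ)` of a cochain. -/
noncomputable def wnorm (X : FinComplex V) {n : ℕ} (A : X.Cochain n) : ℝ :=
  ∑ σ : X.Face n with A σ ≠ 0, X.weight σ.1

open scoped Classical in
/-- The link `X_σ = {τ ∈ X | σ ⊔ τ ∈ X}` (disjoint union) of a face `σ`. -/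
noncomputable def link (X : FinComplex V) (σ : Finset V) (hσ : σ ∈ X.faces) : FinComplex V where
  faces := X.faces.filter (fun τ => Disjoint σ τ ∧ σ ∪ τ ∈ X.faces)
  empty_mem := by simpa using ⟨X.empty_mem, hσ⟩
  down_closed := by
    intro s t hs hts
    simp only [Finset.mem_filter] at hs ⊢
    exact ⟨X.down_closed hs.1 hts, hs.2.1.mono_right hts,
      X.down_closed hs.2.2 (Finset.union_subset_union_right hts)⟩

/-- The `k`-skeleton: all faces of dimension at most `k`. -/
def skeleton (X : FinComplex V) (k : ℕ) : FinComplex V where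
  faces := X.faces.filter (fun s => s.card ≤ k + 1)
  empty_mem := by simpa using X.empty_mem
  down_closed := by
    intro s t hs hts
    simp only [Finset.mem_filter] at hs ⊢
    exact ⟨X.down_closed hs.1 hts, (Finset.card_le_card hts).trans hs.2⟩

/-- `X` is `Q`-bounded degree: `max_{v ∈ X(0)} |X_v| ≤ Q`, where `|X_v|` is the number of all faces
of the link of `v`. -/
def IsBoundedDegree (X : FinComplex V) (Q : ℕ) : Prop :=
  ∀ (v : V) (hv : {v} ∈ X.faces), (X.link {v} hv).faces.card ≤ Q

/-- `Exp_b^k(X) = min {‖δA‖ / min_{b ∈ B^k} ‖A + b‖ | A ∈ C^k \ B^k}`; the minimum over the empty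
set is `+∞`. -/
noncomputable def expB (X : FinComplex V) (k : ℕ) : EReal :=
  ⨅ (A : X.Cochain (k + 1)) (_ : A ∉ X.coboundaries k),
    ((X.wnorm (X.cobd (k + 1) A) / ⨅ b : X.coboundaries k, X.wnorm (A + b.1) : ℝ) : EReal)

/-- `Exp_z^k(X) = min {‖δA‖ / min_{z ∈ Z^k} ‖A + z‖ | A ∈ C^k \ Z^k}`; the minimum over the empty
set is `+∞`. -/
noncomputable def expZ (X : FinComplex V) (k : ℕ) : EReal :=
  ⨅ (A : X.Cochain (k + 1)) (_ : A ∉ X.cocycles k),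
    ((X.wnorm (X.cobd (k + 1) A) / ⨅ z : X.cocycles k, X.wnorm (A + z.1) : ℝ) : EReal)

/-- The `k`-cosystole `Syst^k(X) = min {‖z‖ | z ∈ Z^k \ B^k}`; the minimum over the empty set is
`+∞`. -/
noncomputable def syst (X : FinComplex V) (k : ℕ) : EReal :=
  ⨅ (z : X.Cochain (k + 1)) (_ : z ∈ X.cocycles k ∧ z ∉ X.coboundaries k),
    ((X.wnorm z : ℝ) : EReal)

/-- `Exp_b^k(X) ≥ ε` for all `0 ≤ k ≤ dim X - 1`. -/
def IsCoboundaryExpander (X : FinComplex V) (ε : ℝ) : Prop :=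
  ∀ k : ℕ, k + 1 < X.size → (ε : EReal) ≤ X.expB k

/-- `Exp_z^k(X) ≥ ε` and `Syst^k(X) ≥ μ` for all `0 ≤ k ≤ dim X - 1`. -/
def IsCosystolicExpander (X : FinComplex V) (ε μ : ℝ) : Prop :=
  ∀ k : ℕ, k + 1 < X.size → (ε : EReal) ≤ X.expZ k ∧ (μ : EReal) ≤ X.syst k

open scoped Classical in
/-- `E(A, A)`: the set of edges of `X` both of whose vertices lie in `A ⊆ X(0)`. -/
noncomputable def edgesWithin (X : FinComplex V) (A : X.Cochain 1) : X.Cochain 2 :=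
  fun e => if ∀ v : X.Face 1, v.1 ⊆ e.1 → A v ≠ 0 then 1 else 0

/-- `‖E(A, A)‖ ≤ 4 (‖A‖² + α ‖A‖)` for every set `A` of vertices. -/
def IsSkeletonExpander (X : FinComplex V) (α : ℝ) : Prop :=
  ∀ A : X.Cochain 1, X.wnorm (X.edgesWithin A) ≤ 4 * (X.wnorm A ^ 2 + α * X.wnorm A)

end FinComplex

/-! The core claim is that a small, locally minimal cocycle `A` is empty. Locally minimal means that
adding the coboundary of a cochain supported above a nonempty face never decreases the norm. Call
every member of `A` fat, and, going down one dimension at a time, call a face fat if the fat faces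
with one more vertex occupy a definite proportion of its link. If `A` is small, the empty face is
not fat, so deleting vertices through fat faces leads from each member of `A` to a nonempty minimal
fat face `s`.

Let `L s` be the part of `A` that descends to `s`. Local minimality and coboundary expansion of the
link of `s` bound `L s` by its coboundary above `s`. As `A` is a cocycle, a face of that coboundary
must be degenerate: it contains two fat faces with a common cover whose intersection `ρ` is not fat
(`not_nondegenerate_of_mem_bd`). The fat faces just above such a `ρ` are sparse in its link, so
skeleton expansion makes degenerate faces rare (`mass_degenerate_le`). Summing over `s` gives `β *
mass A ≤ const * δ * mass A`, hence `A = ∅` for small `δ` (`IsDComplex.eq_empty_of_small`).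

Bounded degree enters afterwards. For a small cocycle `A`, minimizing the norm of `A + δG` plus a
small multiple of the norm of `G` makes `A + δG` locally minimal, hence zero, so `A` is a coboundary
with a controlled filling (`exists_bd_eq`). This bounds the cosystoles, and applied to the cocycle
`δA` it gives cocycle expansion (`exists_bd_eq_bd`). In the skeleton's own norm all weights change
by a factor of at most `Q`. -/

namespace FinComplex

open Finset
open scoped Classical

variable {V : Type*}

/-! ### Unnormalized, integer-valued norms of sets of faces. -/

/-- The number of top-dimensional faces containing `s`. -/
noncomputable def topCount (X : FinComplex V) (s : Finset V) : ℕ :=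
  #{F ∈ X.facesCard X.size | s ⊆ F}

/-- The total number of pairs of a member of `A` and a top-dimensional face containing it. -/
noncomputable def mass (X : FinComplex V) (A : Finset (Finset V)) : ℕ :=
  ∑ s ∈ A, X.topCount s

/-- The coboundary of a set of faces with `n` vertices. -/
noncomputable def bd (X : FinComplex V) (n : ℕ) (A : Finset (Finset V)) : Finset (Finset V) :=
  {t ∈ X.facesCard (n + 1) | Odd #{p ∈ A | p ⊆ t}}

variable {X : FinComplex V} {d n m : ℕ}

theorem mem_facesCard {s : Finset V} : s ∈ X.facesCard n ↔ s ∈ X.faces ∧ s.card = n := by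
  simp [facesCard]

theorem mem_bd {A : Finset (Finset V)} {t : Finset V} :
    t ∈ X.bd n A ↔ t ∈ X.facesCard (n + 1) ∧ Odd #{p ∈ A | p ⊆ t} := by
  simp [bd]

theorem bd_subset (A : Finset (Finset V)) : X.bd n A ⊆ X.facesCard (n + 1) :=
  filter_subset _ _

theorem odd_card_symmDiff {α : Type*} [DecidableEq α] (A B : Finset α) :
    Odd #(symmDiff A B) ↔ (Odd #A ↔ ¬ Odd #B) := by
  have h1 : #(symmDiff A B) = #(A \ B) + #(B \ A) := by
    rw [symmDiff_def, sup_eq_union, card_union_of_disjoint disjoint_sdiff_sdiff]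
  have h2 := card_sdiff_add_card_inter A B
  have h3 := card_sdiff_add_card_inter B A
  rw [inter_comm] at h3
  rw [h1]
  simp only [Nat.odd_iff]
  omega

theorem bd_symmDiff (A B : Finset (Finset V)) :
    X.bd n (symmDiff A B) = symmDiff (X.bd n A) (X.bd n B) := by
  ext t
  have h : {p ∈ symmDiff A B | p ⊆ t} = symmDiff {p ∈ A | p ⊆ t} {p ∈ B | p ⊆ t} := by
    ext p; simp only [mem_filter, mem_symmDiff]; tauto
  simp only [mem_bd, mem_symmDiff, h, odd_card_symmDiff]
  tauto

theorem topCount_anti {s t : Finset V} (h : s ⊆ t) : X.topCount t ≤ X.topCount s :=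
  card_le_card fun F hF => by
    simp only [mem_filter] at hF ⊢
    exact ⟨hF.1, h.trans hF.2⟩

theorem IsDComplex.topCount_pos (hX : X.IsDComplex d) {s : Finset V} (hs : s ∈ X.faces) :
    0 < X.topCount s := by
  obtain ⟨t, ht, hst, hc⟩ := hX.2 s hs
  exact card_pos.2 ⟨t, by simp [mem_facesCard, ht, hst, hc, hX.1]⟩

theorem card_le_size {s : Finset V} (hs : s ∈ X.faces) : s.card ≤ X.size :=
  Finset.le_sup (f := Finset.card) hs

theorem mass_mono {A B : Finset (Finset V)} (h : A ⊆ B) : X.mass A ≤ X.mass B :=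
  sum_le_sum_of_subset h

theorem mass_union_le (A B : Finset (Finset V)) : X.mass (A ∪ B) ≤ X.mass A + X.mass B := by
  unfold mass
  rw [← sum_union_inter]
  exact Nat.le_add_right _ _

theorem mass_biUnion_le {ι : Type*} (s : Finset ι) (f : ι → Finset (Finset V)) :
    X.mass (s.biUnion f) ≤ ∑ i ∈ s, X.mass (f i) := by
  induction s using Finset.induction_on with
  | empty => simp [mass]
  | insert a s ha ih =>
    rw [biUnion_insert, sum_insert ha]
    exact (mass_union_le _ _).trans (Nat.add_le_add_left ih _)

theorem IsDComplex.eq_empty_of_mass_eq_zero (hX : X.IsDComplex d) {A : Finset (Finset V)}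
    (hA : A ⊆ X.facesCard n) (h : X.mass A = 0) : A = ∅ := by
  by_contra hne
  obtain ⟨s, hs⟩ := nonempty_iff_ne_empty.2 hne
  have h1 := (sum_eq_zero_iff.1 h) s hs
  exact (hX.topCount_pos (mem_facesCard.1 (hA hs)).1).ne' h1

/-- Double counting of the pairs `s ⊆ t`. -/
theorem sum_sum_subset_le (S B : Finset (Finset V)) (w : Finset V → ℕ) {m : ℕ}
    (hB : ∀ t ∈ B, t.card ≤ m) :
    ∑ s ∈ S, ∑ t ∈ B with s ⊆ t, w t ≤ 2 ^ m * ∑ t ∈ B, w t := by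
  have h : ∑ s ∈ S, ∑ t ∈ B with s ⊆ t, w t = ∑ t ∈ B, ∑ s ∈ S with s ⊆ t, w t := by
    simp only [sum_filter]
    exact sum_comm
  rw [h, mul_sum]
  refine sum_le_sum fun t ht => ?_
  rw [sum_const, smul_eq_mul]
  refine Nat.mul_le_mul_right _ ?_
  calc #{s ∈ S | s ⊆ t} ≤ #t.powerset := card_le_card fun s hs => by
        simpa using (mem_filter.1 hs).2
    _ = 2 ^ t.card := card_powerset t
    _ ≤ 2 ^ m := Nat.pow_le_pow_right (by norm_num) (hB t ht)

theorem mass_supersets_le (X : FinComplex V) (g : Finset V) (n : ℕ) :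
    X.mass {t ∈ X.facesCard n | g ⊆ t} ≤ 2 ^ X.size * X.topCount g := by
  have h := sum_sum_subset_le {t ∈ X.facesCard n | g ⊆ t} {F ∈ X.facesCard X.size | g ⊆ F}
    (fun _ => 1) (m := X.size) (by
      intro t ht
      simp only [mem_filter, mem_facesCard] at ht
      exact ht.1.2.le)
  simp only [sum_const, smul_eq_mul, mul_one] at h
  refine le_trans (sum_le_sum fun t ht => ?_) h
  refine card_le_card fun F hF => ?_
  simp only [mem_filter] at hF ht ⊢
  exact ⟨⟨hF.1, ht.2.trans hF.2⟩, hF.2⟩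

theorem mass_facesCard_le (X : FinComplex V) (n : ℕ) :
    X.mass (X.facesCard n) ≤ 2 ^ X.size * X.topCount ∅ := by
  simpa using X.mass_supersets_le ∅ n

/-! ### Dictionary between cochains and sets of faces. -/

/-- The set of faces with `n` vertices. -/
noncomputable def supp {n : ℕ} (f : X.Cochain n) : Finset (Finset V) :=
  (univ.filter fun s => f s ≠ 0).map (Function.Embedding.subtype _)

/-- The indicator cochain of a set of faces. -/
noncomputable def indicator (X : FinComplex V) (n : ℕ) (A : Finset (Finset V)) : X.Cochain n :=
  fun s => if s.1 ∈ A then 1 else 0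

theorem mem_supp {f : X.Cochain n} {s : Finset V} :
    s ∈ supp f ↔ ∃ h : s ∈ X.facesCard n, f ⟨s, h⟩ ≠ 0 := by
  simp [supp]

theorem supp_subset (f : X.Cochain n) : supp f ⊆ X.facesCard n := fun _ h => (mem_supp.1 h).1

theorem supp_indicator {A : Finset (Finset V)} (hA : A ⊆ X.facesCard n) :
    supp (X.indicator n A) = A := by
  ext s
  simp only [mem_supp, indicator]
  constructor
  · rintro ⟨_, h⟩
    by_contra hs
    simp [hs] at h
  · intro h
    exact ⟨hA h, by simp [h]⟩

theorem supp_injective : Function.Injective (supp : X.Cochain n → _) := by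
  intro f g h
  have key : ∀ a b : ZMod 2, (a ≠ 0 ↔ b ≠ 0) → a = b := by decide
  funext s
  apply key
  have := Finset.ext_iff.1 h s.1
  simpa [mem_supp, s.2] using this

theorem supp_add (f g : X.Cochain n) : supp (f + g) = symmDiff (supp f) (supp g) := by
  have key : ∀ a b : ZMod 2, a + b ≠ 0 ↔ (a ≠ 0 ∧ ¬ b ≠ 0 ∨ b ≠ 0 ∧ ¬ a ≠ 0) := by decide
  ext s
  rw [mem_symmDiff]
  by_cases hs : s ∈ X.facesCard n
  · simpa [mem_supp, hs] using key (f ⟨s, hs⟩) (g ⟨s, hs⟩)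
  · simp [mem_supp, hs]

theorem supp_cobd (f : X.Cochain n) : supp (X.cobd n f) = X.bd n (supp f) := by
  ext t
  rw [mem_supp, mem_bd]
  have key : ∀ a : ZMod 2, a = if a ≠ 0 then 1 else 0 := by decide
  have hcard : ∀ t : Finset V, ∑ s : X.Face n with s.1 ⊆ t, f s =
      ((#{p ∈ supp f | p ⊆ t} : ℕ) : ZMod 2) := by
    intro t
    have h1 : {p ∈ supp f | p ⊆ t} =
        ((univ.filter fun s : X.Face n => s.1 ⊆ t).filter fun s => f s ≠ 0).map
          (Function.Embedding.subtype _) := by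
      ext p
      simp only [mem_filter, mem_supp, mem_map, mem_univ, true_and, Function.Embedding.subtype_apply]
      constructor
      · rintro ⟨⟨h, h'⟩, h''⟩
        exact ⟨⟨p, h⟩, ⟨h'', h'⟩, rfl⟩
      · rintro ⟨a, ⟨h, h'⟩, rfl⟩
        exact ⟨⟨a.2, h'⟩, h⟩
    rw [h1, card_map, card_filter, Nat.cast_sum]
    refine sum_congr rfl fun s _ => ?_
    rw [Nat.cast_ite, Nat.cast_one, Nat.cast_zero]
    exact key (f s)
  simp only [cobd, LinearMap.coe_mk, AddHom.coe_mk, hcard, ne_eq,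
    ZMod.natCast_eq_zero_iff_even, Nat.not_even_iff_odd, exists_prop]

theorem wnorm_eq_sum (f : X.Cochain n) : X.wnorm f = ∑ s ∈ supp f, X.weight s := by
  simp [wnorm, supp]

theorem weight_nonneg (X : FinComplex V) (s : Finset V) : 0 ≤ X.weight s := by
  unfold weight; positivity

theorem topCount_empty (X : FinComplex V) : X.topCount ∅ = #(X.facesCard X.size) := by
  simp [topCount]

theorem wnorm_eq_mass (f : X.Cochain n) :
    X.wnorm f = X.mass (supp f) / ((X.size.choose n : ℝ) * X.topCount ∅) := by
  rw [wnorm_eq_sum, mass, Nat.cast_sum, sum_div, topCount_empty]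
  refine sum_congr rfl fun s hs => ?_
  rw [weight, (mem_facesCard.1 (supp_subset f hs)).2]
  rfl

/-! ### Descending chains of fat faces. -/

section Ladder

variable (F : Set (Finset V))

/-- `b` is a member of `F` obtained from `a` by deleting a vertex. -/
def Step (a b : Finset V) : Prop := ∃ x ∈ a, b = a.erase x ∧ b ∈ F

/-- `s` can be reached from `p` by deleting vertices one by one within `F`. -/
abbrev Ladder : Finset V → Finset V → Prop := Relation.ReflTransGen (Step F)

/-- Any two members of `F` below `τ` with a common cover below `τ` intersect in a member of `F`. -/
def Nondegenerate (τ : Finset V) : Prop :=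
  ∀ g ⊆ τ, ∀ x ∈ g, ∀ y ∈ g, x ≠ y → g.erase x ∈ F → g.erase y ∈ F → (g.erase x).erase y ∈ F

variable {F}

theorem Ladder.subset {p s : Finset V} (h : Ladder F p s) : s ⊆ p := by
  induction h with
  | refl => exact Subset.rfl
  | tail _ hbc ih =>
    obtain ⟨x, _, rfl, _⟩ := hbc
    exact (erase_subset _ _).trans ih

/-- The deletion of `y` is carried down the ladder, nondegeneracy closing the square at every step.
Either the ladder itself deletes `y` at some point and the two paths merge, or `y` survives to the
bottom and can be deleted from `s`. -/
theorem Ladder.erase {τ p s : Finset V} (hτ : Nondegenerate F τ) (h : Ladder F p s) {y : V}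
    (hpτ : p ⊆ τ) (hy : y ∈ p) (hpy : p.erase y ∈ F) :
    (y ∈ s ∧ s.erase y ∈ F) ∨ Ladder F (p.erase y) s := by
  induction h using Relation.ReflTransGen.head_induction_on with
  | refl => exact Or.inl ⟨hy, hpy⟩
  | head hstep hrest ih =>
    obtain ⟨x, hx, rfl, hF⟩ := hstep
    by_cases hxy : x = y
    · subst hxy
      exact Or.inr hrest
    · have h1 := hτ _ hpτ x hx y hy hxy hF hpy
      refine (ih ((erase_subset _ _).trans hpτ) (mem_erase.2 ⟨Ne.symm hxy, hy⟩) h1).imp id ?_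
      refine Relation.ReflTransGen.head ⟨x, mem_erase.2 ⟨hxy, hx⟩, erase_right_comm, h1⟩

/-- The intersection of the facets `p` and `q` of `τ` is in `F`. Minimality of `s` excludes the
first alternative of `Ladder.erase`, so this intersection still descends to `s`, and it is one step
below `q`. -/
theorem Ladder.of_nondegenerate {τ p q s : Finset V} (hτ : Nondegenerate F τ) (h : Ladder F p s)
    (hs : ∀ y ∈ s, s.erase y ∉ F) (hpτ : p ⊆ τ) (hqτ : q ⊆ τ) (hp : p.card + 1 = τ.card)
    (hq : q.card + 1 = τ.card) (hpF : p ∈ F) (hqF : q ∈ F) : Ladder F q s := by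
  have key : ∀ p ⊆ τ, p.card + 1 = τ.card → ∃ a ∈ τ, p = τ.erase a := by
    intro p hpτ hp
    obtain ⟨a, ha, rfl⟩ := (covBy_iff_exists_insert (s := p) (t := τ)).1
      (covBy_iff_card_sdiff_eq_one.2 ⟨hpτ, by rw [card_sdiff_of_subset hpτ]; omega⟩)
    exact ⟨a, mem_insert_self _ _, (erase_insert ha).symm⟩
  obtain ⟨a, ha, rfl⟩ := key p hpτ hp
  obtain ⟨b, hb, rfl⟩ := key q hqτ hq
  by_cases hab : a = b
  · rwa [← hab]
  have h1 := hτ τ Subset.rfl a ha b hb hab hpF hqF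
  rcases h.erase hτ hpτ (mem_erase.2 ⟨Ne.symm hab, hb⟩) h1 with h2 | h2
  · exact absurd h2.2 (hs b h2.1)
  · exact Relation.ReflTransGen.head ⟨a, mem_erase.2 ⟨hab, ha⟩, erase_right_comm, h1⟩ h2

theorem exists_ladder_minimal {p : Finset V} (hp : p ∈ F) :
    ∃ s ∈ F, Ladder F p s ∧ ∀ y ∈ s, s.erase y ∉ F := by
  induction p using Finset.strongInduction with
  | H p ih =>
    by_cases h : ∀ y ∈ p, p.erase y ∉ F
    · exact ⟨p, hp, Relation.ReflTransGen.refl, h⟩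
    · push Not at h
      obtain ⟨y, hy, hF⟩ := h
      obtain ⟨s, hs, hl, hm⟩ := ih _ (erase_ssubset hy) hF
      exact ⟨s, hs, hl.head ⟨y, hy, rfl, hF⟩, hm⟩

end Ladder

/-- If `A` is a cocycle, the coboundary of the part of `A` above a minimal fat face consists of
degenerate faces. -/
theorem not_nondegenerate_of_mem_bd {F : Set (Finset V)} {A : Finset (Finset V)}
    (hA : A ⊆ X.facesCard n) (hAF : ∀ p ∈ A, p ∈ F) (hbd : X.bd n A = ∅) {s τ : Finset V}
    (hs : ∀ y ∈ s, s.erase y ∉ F) (hτ : τ ∈ X.bd n {p ∈ A | Ladder F p s}) :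
    ¬ Nondegenerate F τ := by
  intro hN
  rw [mem_bd] at hτ
  obtain ⟨hτ, hodd⟩ := hτ
  obtain ⟨p, hp⟩ := card_pos.1 hodd.pos
  simp only [mem_filter] at hp
  have hc : ∀ p ∈ A, p.card + 1 = τ.card := fun p hp => by
    rw [(mem_facesCard.1 (hA hp)).2, (mem_facesCard.1 hτ).2]
  -- Once one facet of `τ` in `A` descends to `s`, all of them do, so the parity at `τ` is that of
  -- the cocycle `A`.
  have : {p ∈ {p ∈ A | Ladder F p s} | p ⊆ τ} = {p ∈ A | p ⊆ τ} := by
    ext q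
    simp only [mem_filter]
    exact ⟨fun h => ⟨h.1.1, h.2⟩, fun h => ⟨⟨h.1, hp.1.2.of_nondegenerate hN hs hp.2 h.2
      (hc p hp.1.1) (hc q h.1) (hAF p hp.1.1) (hAF q h.1)⟩, h.2⟩⟩
  rw [this] at hodd
  have h1 : τ ∈ X.bd n A := mem_bd.2 ⟨hτ, hodd⟩
  simp [hbd] at h1

/-! ### Fat and degenerate faces. -/

/-- The fat faces with `n - t` vertices. -/
noncomputable def layer (X : FinComplex V) (n : ℕ) (A : Finset (Finset V)) (δ : ℝ) :
    ℕ → Finset (Finset V)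
  | 0 => A
  -- The thresholds used up to layer `t` multiply to `δ ^ (2 ^ t - 1)`, one factor `δ` short of the
  -- new threshold `δ ^ 2 ^ t`. This spare factor is the gain in `mass_degenerate_le`.
  | t + 1 => {s ∈ X.faces | s.card + (t + 1) = n ∧
      δ ^ 2 ^ t * X.topCount s ≤ X.mass {p ∈ layer X n A δ t | s ⊆ p}}

theorem layer_subset {A : Finset (Finset V)} {δ : ℝ} (hA : A ⊆ X.facesCard n) {t : ℕ}
    {s : Finset V} (hs : s ∈ X.layer n A δ t) : s ∈ X.faces ∧ s.card + t = n := by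
  cases t with
  | zero => simpa [mem_facesCard] using hA hs
  | succ t =>
    rw [layer, mem_filter] at hs
    exact ⟨hs.1, hs.2.1⟩

/-- Markov's inequality, layer after layer: passing from layer `t` to the next costs the inverse
threshold and a factor `2 ^ X.size` for double counting, and `1 + 2 + ⋯ + 2 ^ (t - 1) = 2 ^ t - 1`.
-/
theorem mass_layer_le {A : Finset (Finset V)} {δ : ℝ} (hδ : 0 ≤ δ) (hA : A ⊆ X.facesCard n)
    (t : ℕ) :
    X.mass (X.layer n A δ t) * δ ^ (2 ^ t - 1) ≤ (2 ^ X.size) ^ t * (X.mass A : ℝ) := by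
  induction t with
  | zero => simp [layer]
  | succ t ih =>
    have h1 : δ ^ 2 ^ t * X.mass (X.layer n A δ (t + 1)) ≤
        2 ^ X.size * X.mass (X.layer n A δ t) := by
      have h2 := sum_sum_subset_le (X.layer n A δ (t + 1)) (X.layer n A δ t) X.topCount
        (m := X.size) fun s hs => card_le_size (layer_subset hA hs).1
      calc δ ^ 2 ^ t * (X.mass (X.layer n A δ (t + 1)) : ℝ)
          = ∑ s ∈ X.layer n A δ (t + 1), δ ^ 2 ^ t * X.topCount s := by
            rw [mass, Nat.cast_sum, mul_sum]
        _ ≤ ∑ s ∈ X.layer n A δ (t + 1),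
              ((∑ p ∈ X.layer n A δ t with s ⊆ p, X.topCount p : ℕ) : ℝ) := by
            refine sum_le_sum fun s hs => ?_
            rw [layer, mem_filter] at hs
            exact hs.2.2
        _ ≤ _ := by rw [mass]; exact_mod_cast h2
    have h3 : 2 ^ (t + 1) - 1 = 2 ^ t + (2 ^ t - 1) := by
      have := Nat.one_le_two_pow (n := t)
      rw [pow_succ]; omega
    calc X.mass (X.layer n A δ (t + 1)) * δ ^ (2 ^ (t + 1) - 1)
        = (δ ^ 2 ^ t * X.mass (X.layer n A δ (t + 1))) * δ ^ (2 ^ t - 1) := by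
          rw [h3, pow_add]; ring
      _ ≤ (2 ^ X.size * X.mass (X.layer n A δ t)) * δ ^ (2 ^ t - 1) := by gcongr
      _ = 2 ^ X.size * (X.mass (X.layer n A δ t) * δ ^ (2 ^ t - 1)) := by ring
      _ ≤ 2 ^ X.size * ((2 ^ X.size) ^ t * (X.mass A : ℝ)) := by gcongr
      _ = _ := by ring

/-- The faces `ρ ∪ {x, y}` with `ρ ∪ {x}` and `ρ ∪ {y}` in `T`. -/
noncomputable def around (X : FinComplex V) (ρ : Finset V) (T : Finset (Finset V)) :
    Finset (Finset V) :=
  {g ∈ X.facesCard (ρ.card + 2) | ρ ⊆ g ∧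
    ∀ t, ρ ⊆ t → t ⊆ g → t.card = ρ.card + 1 → t ∈ T}

/-- The degenerate faces arising from two fat faces with `n - t` vertices. -/
noncomputable def degenerate (X : FinComplex V) (n : ℕ) (A : Finset (Finset V)) (δ : ℝ) (t : ℕ) :
    Finset (Finset V) :=
  {ρ ∈ X.faces | ρ.card + (t + 1) = n ∧ ρ ∉ X.layer n A δ (t + 1)}.biUnion fun ρ =>
    (X.around ρ {p ∈ X.layer n A δ t | ρ ⊆ p}).biUnion fun g =>
      {τ ∈ X.facesCard (n + 1) | g ⊆ τ}

/-- The set of all fat faces. -/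
def fat (X : FinComplex V) (n : ℕ) (A : Finset (Finset V)) (δ : ℝ) : Set (Finset V) :=
  {s | ∃ t, s ∈ X.layer n A δ t}

theorem mem_layer_of_fat {A : Finset (Finset V)} {δ : ℝ} (hA : A ⊆ X.facesCard n) {s : Finset V}
    {t : ℕ} (hs : s ∈ X.fat n A δ) (ht : s.card + t = n) : s ∈ X.layer n A δ t := by
  obtain ⟨u, hu⟩ := hs
  have := (layer_subset hA hu).2
  obtain rfl : u = t := by omega
  exact hu

/-- In a failing square the two fat faces have equal size, hence lie in one layer, and they are the
only faces strictly between their intersection and their union. -/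
theorem mem_degenerate {A : Finset (Finset V)} {δ : ℝ} (hA : A ⊆ X.facesCard n) {τ : Finset V}
    (hτ : τ ∈ X.facesCard (n + 1)) (h : ¬ Nondegenerate (X.fat n A δ) τ) :
    ∃ t < n, τ ∈ X.degenerate n A δ t := by
  unfold Nondegenerate at h
  push Not at h
  obtain ⟨g, hg, x, hx, y, hy, hxy, ⟨t, ht⟩, hyF, hρ⟩ := h
  have hcx := card_erase_add_one hx
  have hcy := card_erase_add_one hy
  have hyx : y ∈ g.erase x := mem_erase.2 ⟨Ne.symm hxy, hy⟩
  have hcρ := card_erase_add_one hyx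
  have ht' := layer_subset hA ht
  have hgX := X.down_closed (mem_facesCard.1 hτ).1 hg
  have hyL : g.erase y ∈ X.layer n A δ t := mem_layer_of_fat hA hyF (by omega)
  refine ⟨t, by omega, ?_⟩
  simp only [degenerate, mem_biUnion, mem_filter, around]
  have hsub : (g.erase x).erase y ⊆ g := (erase_subset _ _).trans (erase_subset _ _)
  refine ⟨(g.erase x).erase y, ⟨X.down_closed ht'.1 (erase_subset _ _), by omega,
    fun h => hρ ⟨_, h⟩⟩, g, ⟨mem_facesCard.2 ⟨hgX, by omega⟩, hsub, ?_⟩, hτ, hg⟩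
  intro u hu hug huc
  refine ⟨?_, hu⟩
  obtain ⟨z, hz, hzu⟩ := exists_of_ssubset (ssubset_of_subset_of_ne hug (by
    rintro rfl; omega))
  have huz : u = g.erase z := by
    refine eq_of_subset_of_card_le (subset_erase.2 ⟨hug, hzu⟩) ?_
    have := card_erase_add_one hz
    omega
  have : z = x ∨ z = y := by
    by_contra hne
    push Not at hne
    exact hzu (hu (mem_erase.2 ⟨hne.2, mem_erase.2 ⟨hne.1, hz⟩⟩))
  rcases this with rfl | rfl
  · exact huz ▸ ht
  · exact huz ▸ hyL

/-- Since `ρ` is not fat, the layer above it has density at most `δ ^ 2 ^ t`, and skeleton expansion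
at `ρ` gains this factor. Summing over `ρ`, `mass_layer_le` consumes all but one power of `δ`. -/
theorem mass_degenerate_le {A : Finset (Finset V)} {δ α K : ℝ} (hδ : 0 < δ) (hK : 0 ≤ K)
    (hA : A ⊆ X.facesCard n) (hn : n ≤ d)
    (hskel : ∀ ρ ∈ X.faces, ρ.card + 1 ≤ d → ∀ T ⊆ X.facesCard (ρ.card + 1), (∀ t ∈ T, ρ ⊆ t) →
      ∀ η : ℝ, X.mass T ≤ η * X.topCount ρ → X.mass (X.around ρ T) ≤ K * (η + α) * X.mass T)
    {t : ℕ} (hα : α ≤ δ ^ 2 ^ t) :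
    (X.mass (X.degenerate n A δ t) : ℝ) ≤ 2 * K * (2 ^ X.size) ^ (t + 2) * δ * X.mass A := by
  set S := {ρ ∈ X.faces | ρ.card + (t + 1) = n ∧ ρ ∉ X.layer n A δ (t + 1)} with hS
  set T : Finset V → Finset (Finset V) := fun ρ => {p ∈ X.layer n A δ t | ρ ⊆ p} with hT
  have h1 : X.mass (X.degenerate n A δ t) ≤
      ∑ ρ ∈ S, 2 ^ X.size * X.mass (X.around ρ (T ρ)) := by
    refine (mass_biUnion_le _ _).trans (sum_le_sum fun ρ _ => ?_)
    refine (mass_biUnion_le _ _).trans ?_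
    conv_rhs => rw [mass, mul_sum]
    exact sum_le_sum fun g _ => X.mass_supersets_le g (n + 1)
  have h2 : ∀ ρ ∈ S, (X.mass (X.around ρ (T ρ)) : ℝ) ≤ 2 * K * δ ^ 2 ^ t * X.mass (T ρ) := by
    intro ρ hρ
    simp only [hS, mem_filter] at hρ
    obtain ⟨hρX, hρc, hρ⟩ := hρ
    have h3 : (X.mass (T ρ) : ℝ) ≤ δ ^ 2 ^ t * X.topCount ρ := by
      by_contra hlt
      refine hρ ?_
      rw [layer, mem_filter]
      exact ⟨hρX, hρc, (not_le.1 hlt).le⟩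
    refine (hskel ρ hρX (by omega) (T ρ) ?_ ?_ _ h3).trans ?_
    · intro p hp
      have := layer_subset hA (mem_filter.1 hp).1
      exact mem_facesCard.2 ⟨this.1, by omega⟩
    · exact fun p hp => (mem_filter.1 hp).2
    · have : K * (δ ^ 2 ^ t + α) ≤ 2 * K * δ ^ 2 ^ t := by
        nlinarith [mul_le_mul_of_nonneg_left hα hK]
      gcongr
  have h4 : ∑ ρ ∈ S, X.mass (T ρ) ≤ 2 ^ X.size * X.mass (X.layer n A δ t) :=
    sum_sum_subset_le S (X.layer n A δ t) X.topCount
      fun s hs => card_le_size (layer_subset hA hs).1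
  have h5 : δ ^ 2 ^ t = δ * δ ^ (2 ^ t - 1) := by
    rw [← pow_succ', Nat.sub_add_cancel Nat.one_le_two_pow]
  calc (X.mass (X.degenerate n A δ t) : ℝ)
      ≤ ∑ ρ ∈ S, 2 ^ X.size * (X.mass (X.around ρ (T ρ)) : ℝ) := by exact_mod_cast h1
    _ ≤ ∑ ρ ∈ S, 2 ^ X.size * (2 * K * δ ^ 2 ^ t * X.mass (T ρ)) := by
        gcongr with ρ hρ; exact h2 ρ hρ
    _ = 2 ^ X.size * (2 * K * δ ^ 2 ^ t) * ((∑ ρ ∈ S, X.mass (T ρ) : ℕ) : ℝ) := by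
        rw [Nat.cast_sum, mul_sum]; exact sum_congr rfl fun _ _ => by ring
    _ ≤ 2 ^ X.size * (2 * K * δ ^ 2 ^ t) * (2 ^ X.size * X.mass (X.layer n A δ t)) := by
        gcongr; exact_mod_cast h4
    _ = (2 ^ X.size) ^ 2 * (2 * K * δ) * (X.mass (X.layer n A δ t) * δ ^ (2 ^ t - 1)) := by
        rw [h5]; ring
    _ ≤ (2 ^ X.size) ^ 2 * (2 * K * δ) * ((2 ^ X.size) ^ t * X.mass A) := by
        exact mul_le_mul_of_nonneg_left (mass_layer_le hδ.le hA t) (by positivity)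
    _ = _ := by ring

/-! ### Vanishing of small locally minimal cocycles. -/

/-- Small cocycles with expanding local parts vanish. -/
theorem IsDComplex.eq_empty_of_small (hX : X.IsDComplex d) {A : Finset (Finset V)} {δ α K β : ℝ}
    (hδ : 0 < δ) (hδ1 : δ ≤ 1) (hK : 0 ≤ K) (hn : n ≤ d) (hA : A ⊆ X.facesCard n)
    (hbd : X.bd n A = ∅)
    (hskel : ∀ ρ ∈ X.faces, ρ.card + 1 ≤ d → ∀ T ⊆ X.facesCard (ρ.card + 1), (∀ t ∈ T, ρ ⊆ t) →
      ∀ η : ℝ, X.mass T ≤ η * X.topCount ρ → X.mass (X.around ρ T) ≤ K * (η + α) * X.mass T)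
    (hexp : ∀ s ∈ X.faces, s.Nonempty → ∀ L ⊆ A, (∀ p ∈ L, s ⊆ p) →
      β * X.mass L ≤ X.mass {τ ∈ X.bd n L | s ⊆ τ})
    (hα : α ≤ δ ^ 2 ^ d)
    (hδβ : (d + 1) * (2 * K * (2 ^ (d + 1)) ^ (d + 3)) * δ < β)
    (hsmall : (2 ^ (d + 1)) ^ d * (X.mass A : ℝ) < δ ^ 2 ^ d * X.topCount ∅) : A = ∅ := by
  have hsz : X.size = d + 1 := hX.1
  set C : ℝ := 2 ^ (d + 1) with hC
  have hC1 : 1 ≤ C := one_le_pow₀ (by norm_num)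
  set F := X.fat n A δ with hF
  have hAF : ∀ p ∈ A, p ∈ F := fun p hp => ⟨0, hp⟩
  -- If the empty face were fat, layer `n` would have mass at least `X.topCount ∅`, which
  -- `mass_layer_le` forbids for small `A`.
  have hempty : ∅ ∉ F := by
    intro h
    have h1 := mem_layer_of_fat hA h (t := n) (by simp)
    have h2 : X.topCount ∅ ≤ X.mass (X.layer n A δ n) :=
      single_le_sum (f := X.topCount) (fun _ _ => Nat.zero_le _) h1
    have h3 := mass_layer_le hδ.le hA n
    rw [hsz, ← hC] at h3
    have h4 : δ ^ 2 ^ d ≤ δ ^ (2 ^ n - 1) :=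
      pow_le_pow_of_le_one hδ.le hδ1
        ((Nat.sub_le _ _).trans (Nat.pow_le_pow_right (by norm_num) hn))
    have h5 : C ^ n ≤ C ^ d := pow_le_pow_right₀ hC1 hn
    have : δ ^ 2 ^ d * (X.topCount ∅ : ℝ) ≤ C ^ d * (X.mass A : ℝ) := by
      calc δ ^ 2 ^ d * (X.topCount ∅ : ℝ) ≤ δ ^ (2 ^ n - 1) * X.mass (X.layer n A δ n) := by
            gcongr
        _ ≤ C ^ n * X.mass A := by linarith
        _ ≤ _ := by gcongr
    linarith
  set S := {s ∈ X.faces | s ∈ F ∧ ∀ y ∈ s, s.erase y ∉ F} with hS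
  set L : Finset V → Finset (Finset V) := fun s => {p ∈ A | Ladder F p s} with hL
  set D := (range n).biUnion (X.degenerate n A δ) with hD
  have hcover : A ⊆ S.biUnion L := by
    intro p hp
    obtain ⟨s, hs, hl, hm⟩ := exists_ladder_minimal (hAF p hp)
    rw [mem_biUnion]
    refine ⟨s, mem_filter.2 ⟨?_, hs, hm⟩, mem_filter.2 ⟨hp, hl⟩⟩
    exact X.down_closed (mem_facesCard.1 (hA hp)).1 hl.subset
  have hDc : D ⊆ X.facesCard (n + 1) := by
    intro τ hτ
    simp only [hD, degenerate, mem_biUnion, mem_filter] at hτ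
    obtain ⟨_, _, _, _, _, _, h, _⟩ := hτ
    exact h
  have hLD : ∀ s ∈ S, β * X.mass (L s) ≤ X.mass {τ ∈ D | s ⊆ τ} := by
    intro s hs
    rw [hS, mem_filter] at hs
    have hne : s.Nonempty := by
      rw [nonempty_iff_ne_empty]; rintro rfl; exact hempty hs.2.1
    refine (hexp s hs.1 hne (L s) (filter_subset _ _)
      (fun p hp => (mem_filter.1 hp).2.subset)).trans ?_
    refine Nat.cast_le.2 (mass_mono ?_)
    refine filter_subset_filter _ fun τ hτ => ?_
    obtain ⟨t, ht, h⟩ := mem_degenerate hA (bd_subset _ hτ)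
      (not_nondegenerate_of_mem_bd hA hAF hbd hs.2.2 hτ)
    exact mem_biUnion.2 ⟨t, mem_range.2 ht, h⟩
  have hβ : 0 ≤ β := le_trans (by positivity) hδβ.le
  -- The sets `L s` may overlap, which is harmless here. A degenerate face is counted for at most `2
  -- ^ (d + 1)` of its subsets `s`.
  have h1 : β * (X.mass A : ℝ) ≤ C * X.mass D := by
    calc β * (X.mass A : ℝ) ≤ β * ((∑ s ∈ S, X.mass (L s) : ℕ) : ℝ) := by
          gcongr
          exact (mass_mono hcover).trans (mass_biUnion_le _ _)
      _ = ∑ s ∈ S, β * X.mass (L s) := by rw [Nat.cast_sum, mul_sum]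
      _ ≤ ∑ s ∈ S, (X.mass {τ ∈ D | s ⊆ τ} : ℝ) := sum_le_sum hLD
      _ ≤ _ := by
          have := sum_sum_subset_le S D X.topCount (m := d + 1) fun τ hτ => by
            rw [(mem_facesCard.1 (hDc hτ)).2]; omega
          rw [hC]
          exact_mod_cast this
  have h2 : (X.mass D : ℝ) ≤ d * (2 * K * C ^ (d + 1) * δ * X.mass A) := by
    calc (X.mass D : ℝ) ≤ ∑ t ∈ range n, (X.mass (X.degenerate n A δ t) : ℝ) := by
          exact_mod_cast mass_biUnion_le _ _
      _ ≤ ∑ t ∈ range n, 2 * K * C ^ (d + 1) * δ * X.mass A := by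
          refine sum_le_sum fun t ht => ?_
          have ht := mem_range.1 ht
          refine (mass_degenerate_le (d := d) (α := α) hδ hK hA hn hskel
            (hα.trans (pow_le_pow_of_le_one hδ.le hδ1
              (Nat.pow_le_pow_right (by norm_num) (by omega))))).trans ?_
          rw [hsz, ← hC]
          have : C ^ (t + 2) ≤ C ^ (d + 1) := pow_le_pow_right₀ hC1 (by omega)
          gcongr
      _ ≤ _ := by
          rw [sum_const, card_range, nsmul_eq_mul]
          gcongr
  have h3 : C * (X.mass D : ℝ) ≤ (d + 1) * (2 * K * C ^ (d + 3)) * δ * X.mass A := by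
    have h4 : C ^ (d + 2) ≤ C ^ (d + 3) := pow_le_pow_right₀ hC1 (by omega)
    calc C * (X.mass D : ℝ) ≤ C * (d * (2 * K * C ^ (d + 1) * δ * X.mass A)) := by gcongr
      _ = d * (2 * K * C ^ (d + 2)) * δ * X.mass A := by ring
      _ ≤ _ := by gcongr; linarith
  have h4 : (X.mass A : ℝ) ≤ 0 := by
    by_contra hpos
    push Not at hpos
    nlinarith [mul_lt_mul_of_pos_right hδβ hpos]
  exact hX.eq_empty_of_mass_eq_zero hA (by exact_mod_cast le_antisymm h4 (Nat.cast_nonneg _))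

/-! ### Transfer between a link and the faces above it. -/

theorem mem_link {s t : Finset V} {hs : s ∈ X.faces} :
    t ∈ (X.link s hs).faces ↔ Disjoint s t ∧ s ∪ t ∈ X.faces := by
  simp only [link, mem_filter]
  exact ⟨fun h => h.2, fun h => ⟨X.down_closed h.2 subset_union_right, h⟩⟩

theorem sdiff_mem_link {s t : Finset V} {hs : s ∈ X.faces} (ht : t ∈ X.faces) (hst : s ⊆ t) :
    t \ s ∈ (X.link s hs).faces :=
  mem_link.2 ⟨disjoint_sdiff, by rwa [union_sdiff_of_subset hst]⟩

theorem IsDComplex.link (hX : X.IsDComplex d) {s : Finset V} (hs : s ∈ X.faces)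
    (hd : s.card ≤ d) : (X.link s hs).IsDComplex (d - s.card) := by
  have hpure : ∀ t ∈ (X.link s hs).faces, ∃ u ∈ (X.link s hs).faces, t ⊆ u ∧
      u.card = d - s.card + 1 := by
    intro t ht
    rw [mem_link] at ht
    obtain ⟨u, hu, htu, huc⟩ := hX.2 _ ht.2
    have hsu : s ⊆ u := subset_union_left.trans htu
    refine ⟨u \ s, sdiff_mem_link hu hsu, ?_, ?_⟩
    · exact subset_sdiff.2 ⟨subset_union_right.trans htu, ht.1.symm⟩
    · rw [card_sdiff_of_subset hsu]; omega
  refine ⟨le_antisymm (Finset.sup_le fun t ht => ?_) ?_, hpure⟩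
  · rw [mem_link] at ht
    have h1 := card_le_size ht.2
    rw [card_union_of_disjoint ht.1, hX.1] at h1
    omega
  · obtain ⟨u, hu, _, huc⟩ := hpure ∅ (FinComplex.empty_mem _)
    rw [← huc]
    exact card_le_size hu

theorem IsDComplex.topCount_link (hX : X.IsDComplex d) {s t : Finset V} (hs : s ∈ X.faces)
    (hd : s.card ≤ d) : (X.link s hs).topCount t = if Disjoint s t then X.topCount (s ∪ t) else
      0 := by
  have hl : (X.link s hs).size = d - s.card + 1 := (hX.link hs hd).1
  have hl' : X.size = d + 1 := hX.1
  split_ifs with hst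
  · refine card_nbij' (fun F => s ∪ F) (fun F => F \ s) ?_ ?_ ?_ ?_
    · intro F hF
      simp only [coe_filter, Set.mem_ofPred_eq, mem_facesCard, mem_link] at hF ⊢
      refine ⟨⟨hF.1.1.2, ?_⟩, union_subset_union_right hF.2⟩
      rw [card_union_of_disjoint hF.1.1.1]; omega
    · intro F hF
      simp only [coe_filter, Set.mem_ofPred_eq, mem_facesCard] at hF ⊢
      have hsF : s ⊆ F := subset_union_left.trans hF.2
      refine ⟨⟨sdiff_mem_link hF.1.1 hsF, ?_⟩, subset_sdiff.2
        ⟨subset_union_right.trans hF.2, hst.symm⟩⟩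
      rw [card_sdiff_of_subset hsF]; omega
    · intro F hF
      simp only [coe_filter, Set.mem_ofPred_eq, mem_facesCard, mem_link] at hF
      exact union_sdiff_cancel_left hF.1.1.1
    · intro F hF
      simp only [coe_filter, Set.mem_ofPred_eq, mem_facesCard] at hF
      exact union_sdiff_of_subset (subset_union_left.trans hF.2)
  · refine card_eq_zero.2 (filter_eq_empty_iff.2 fun F hF htF => hst ?_)
    rw [mem_facesCard, mem_link] at hF
    exact hF.1.1.mono_right htF

theorem IsDComplex.topCount_link_empty (hX : X.IsDComplex d) {s : Finset V} (hs : s ∈ X.faces)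
    (hd : s.card ≤ d) : (X.link s hs).topCount ∅ = X.topCount s := by
  simp [hX.topCount_link hs hd]

/-- The faces of `X` with `n` vertices which contain `s` and correspond to a member of `L`. -/
noncomputable def lift (X : FinComplex V) (s : Finset V) (n : ℕ) (L : Finset (Finset V)) :
    Finset (Finset V) :=
  {t ∈ X.facesCard n | s ⊆ t ∧ t \ s ∈ L}

theorem mem_lift {s t : Finset V} {L : Finset (Finset V)} :
    t ∈ X.lift s n L ↔ t ∈ X.facesCard n ∧ s ⊆ t ∧ t \ s ∈ L := by simp [lift]

theorem lift_symmDiff (s : Finset V) (L M : Finset (Finset V)) :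
    X.lift s n (symmDiff L M) = symmDiff (X.lift s n L) (X.lift s n M) := by
  ext t
  simp only [mem_lift, mem_symmDiff]
  tauto

theorem lift_image_sdiff {s : Finset V} {L : Finset (Finset V)} (hL : L ⊆ X.facesCard n)
    (hs : ∀ p ∈ L, s ⊆ p) : X.lift s n (L.image (· \ s)) = L := by
  ext t
  simp only [mem_lift, mem_image]
  constructor
  · rintro ⟨_, hst, p, hp, hpt⟩
    have : p = t := by
      rw [← union_sdiff_of_subset hst, ← hpt, union_sdiff_of_subset (hs p hp)]
    exact this ▸ hp
  · exact fun ht => ⟨hL ht, hs t ht, t, ht, rfl⟩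

theorem image_sdiff_subset {s : Finset V} (hs : s ∈ X.faces) {L : Finset (Finset V)}
    (hL : L ⊆ X.facesCard (s.card + m)) (hsL : ∀ p ∈ L, s ⊆ p) :
    L.image (· \ s) ⊆ (X.link s hs).facesCard m := by
  intro t ht
  obtain ⟨p, hp, rfl⟩ := mem_image.1 ht
  have hp' := mem_facesCard.1 (hL hp)
  refine mem_facesCard.2 ⟨sdiff_mem_link hp'.1 (hsL p hp), ?_⟩
  rw [card_sdiff_of_subset (hsL p hp)]; omega

theorem union_mem_facesCard {s t : Finset V} {hs : s ∈ X.faces}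
    (ht : t ∈ (X.link s hs).facesCard m) : s ∪ t ∈ X.facesCard (s.card + m) := by
  rw [mem_facesCard, mem_link] at ht
  exact mem_facesCard.2 ⟨ht.1.2, by rw [card_union_of_disjoint ht.1.1, ht.2]⟩

theorem disjoint_of_mem_facesCard_link {s t : Finset V} {hs : s ∈ X.faces}
    (ht : t ∈ (X.link s hs).facesCard m) : Disjoint s t :=
  (mem_link.1 (mem_facesCard.1 ht).1).1

/-- Top faces of the link are top faces of `X` containing `s`, so without normalization no scaling
factor appears. -/
theorem IsDComplex.mass_link (hX : X.IsDComplex d) {s : Finset V} (hs : s ∈ X.faces)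
    (hd : s.card ≤ d) {L : Finset (Finset V)} (hL : L ⊆ (X.link s hs).facesCard m) :
    (X.link s hs).mass L = X.mass (X.lift s (s.card + m) L) := by
  refine sum_nbij' (fun t => s ∪ t) (fun t => t \ s) ?_ ?_ ?_ ?_ ?_
  · intro t ht
    refine mem_lift.2 ⟨union_mem_facesCard (hL ht), subset_union_left, ?_⟩
    rwa [union_sdiff_cancel_left (disjoint_of_mem_facesCard_link (hL ht))]
  · exact fun t ht => (mem_lift.1 ht).2.2
  · exact fun t ht => union_sdiff_cancel_left (disjoint_of_mem_facesCard_link (hL ht))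
  · exact fun t ht => union_sdiff_of_subset (mem_lift.1 ht).2.1
  · intro t ht
    rw [hX.topCount_link hs hd, if_pos (disjoint_of_mem_facesCard_link (hL ht))]

theorem sdiff_mem_facesCard_link {s t : Finset V} {hs : s ∈ X.faces}
    (ht : t ∈ X.facesCard (s.card + m)) (hst : s ⊆ t) : t \ s ∈ (X.link s hs).facesCard m := by
  rw [mem_facesCard] at ht
  exact mem_facesCard.2 ⟨sdiff_mem_link ht.1 hst, by rw [card_sdiff_of_subset hst]; omega⟩

/-- The facets of `t` that contain `s` correspond to the facets of `t \ s`, so the parities agree.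
-/
theorem lift_bd {s : Finset V} (hs : s ∈ X.faces) {L : Finset (Finset V)}
    (hL : L ⊆ (X.link s hs).facesCard m) :
    X.lift s (s.card + m + 1) ((X.link s hs).bd m L) =
      {t ∈ X.bd (s.card + m) (X.lift s (s.card + m) L) | s ⊆ t} := by
  ext t
  simp only [mem_lift, mem_bd, mem_filter]
  by_cases hst : s ⊆ t
  swap
  · simp [hst]
  have hcard : #{p ∈ L | p ⊆ t \ s} = #{p ∈ X.facesCard (s.card + m) | (s ⊆ p ∧ p \ s ∈ L) ∧
      p ⊆ t} ∨ t ∉ X.facesCard (s.card + m + 1) := by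
    by_cases ht : t ∈ X.facesCard (s.card + m + 1)
    swap
    · exact Or.inr ht
    refine Or.inl (card_nbij' (fun p => s ∪ p) (fun p => p \ s) ?_ ?_ ?_ ?_)
    · intro p hp
      simp only [coe_filter, Set.mem_ofPred_eq] at hp ⊢
      refine ⟨union_mem_facesCard (hL hp.1), ⟨subset_union_left, ?_⟩,
        union_subset hst (hp.2.trans sdiff_subset)⟩
      rw [union_sdiff_cancel_left (disjoint_of_mem_facesCard_link (hL hp.1))]
      exact hp.1
    · intro p hp
      simp only [coe_filter, Set.mem_ofPred_eq] at hp ⊢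
      exact ⟨hp.2.1.2, sdiff_subset_sdiff hp.2.2 Subset.rfl⟩
    · intro p hp
      simp only [coe_filter, Set.mem_ofPred_eq] at hp
      exact union_sdiff_cancel_left (disjoint_of_mem_facesCard_link (hL hp.1))
    · intro p hp
      simp only [coe_filter, Set.mem_ofPred_eq] at hp
      exact union_sdiff_of_subset hp.2.1.1
  have hfil : {p ∈ X.lift s (s.card + m) L | p ⊆ t} =
      {p ∈ X.facesCard (s.card + m) | (s ⊆ p ∧ p \ s ∈ L) ∧ p ⊆ t} := by
    ext p; simp only [mem_lift, mem_filter]; tauto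
  rw [hfil]
  rcases hcard with h | h
  · rw [h]
    constructor
    · exact fun h' => ⟨⟨h'.1, h'.2.2.2⟩, hst⟩
    · exact fun h' => ⟨h'.1.1, hst, sdiff_mem_facesCard_link (by rw [← add_assoc]; exact h'.1.1) hst,
        h'.1.2⟩
  · simp [h]

theorem filter_bd_of_superset {s : Finset V} {L : Finset (Finset V)} (hL : ∀ p ∈ L, s ⊆ p) :
    {t ∈ X.bd n L | s ⊆ t} = X.bd n L := by
  refine filter_true_of_mem fun t ht => ?_
  obtain ⟨p, hp⟩ := card_pos.1 (mem_bd.1 ht).2.pos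
  rw [mem_filter] at hp
  exact (hL p hp.1).trans hp.2

/-! ### Coboundary expansion in links. -/

/-- A minimal `L` realizes the denominator in `expB`; if it has positive mass it is no coboundary,
because adding it to itself would give zero. The factor `2 ^ Y.size` absorbs the binomial
normalizations. -/
theorem mass_mul_le_of_le_expB {Y : FinComplex V} {β : ℝ} (hβ : 0 ≤ β) (hY : 0 < Y.topCount ∅)
    (hm : m + 1 < Y.size) (h : (β : EReal) ≤ Y.expB m) {L : Finset (Finset V)}
    (hL : L ⊆ Y.facesCard (m + 1))
    (hmin : ∀ G ⊆ Y.facesCard m, Y.mass L ≤ Y.mass (symmDiff L (Y.bd m G))) :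
    β * Y.mass L ≤ 2 ^ Y.size * Y.mass (Y.bd (m + 1) L) := by
  by_cases h0 : Y.mass L = 0
  · rw [h0]; simp only [Nat.cast_zero, mul_zero]; positivity
  have hcp : ∀ j ≤ Y.size, (0 : ℝ) < Y.size.choose j := fun j hj => by
    exact_mod_cast Nat.choose_pos hj
  set f := Y.indicator (m + 1) L with hf
  have hsf : supp f = L := supp_indicator hL
  have hmin' : ∀ b ∈ Y.coboundaries m, Y.mass L ≤ Y.mass (supp (f + b)) := by
    rintro b ⟨g, rfl⟩
    rw [supp_add, supp_cobd, hsf]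
    exact hmin _ (supp_subset g)
  have hfB : f ∉ Y.coboundaries m := by
    intro hfB
    have := hmin' f hfB
    rw [supp_add, symmDiff_self] at this
    exact h0 (by simpa [mass] using this)
  have h1 : (β : EReal) ≤ _ := h.trans (iInf₂_le f hfB)
  rw [EReal.coe_le_coe_iff] at h1
  have h2 : Y.wnorm f ≤ ⨅ b : Y.coboundaries m, Y.wnorm (f + b.1) := by
    refine le_ciInf fun b => ?_
    rw [wnorm_eq_mass, wnorm_eq_mass, hsf]
    have := hmin' b.1 b.2
    gcongr
  have h3 : 0 < Y.wnorm f := by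
    rw [wnorm_eq_mass, hsf]
    have := hcp (m + 1) hm.le
    have := Nat.pos_of_ne_zero h0
    positivity
  rw [le_div_iff₀ (h3.trans_le h2)] at h1
  have h4 : β * Y.wnorm f ≤ Y.wnorm (Y.cobd (m + 1) f) :=
    (mul_le_mul_of_nonneg_left h2 hβ).trans h1
  rw [wnorm_eq_mass, wnorm_eq_mass, supp_cobd, hsf, ← mul_div_assoc,
    div_le_div_iff₀ (mul_pos (hcp _ hm.le) (by positivity))
    (mul_pos (hcp _ hm) (by positivity))] at h4
  have h5 : β * Y.mass L * (Y.size.choose (m + 1 + 1)) ≤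
      Y.mass (Y.bd (m + 1) L) * (Y.size.choose (m + 1)) := by
    refine le_of_mul_le_mul_right ?_ (Nat.cast_pos.2 hY : (0 : ℝ) < _)
    linarith
  calc β * (Y.mass L : ℝ) ≤ β * Y.mass L * (Y.size.choose (m + 1 + 1)) := by
        refine le_mul_of_one_le_right (by positivity) ?_
        exact_mod_cast Nat.choose_pos hm
    _ ≤ Y.mass (Y.bd (m + 1) L) * (Y.size.choose (m + 1)) := h5
    _ ≤ Y.mass (Y.bd (m + 1) L) * 2 ^ Y.size := by
        gcongr; exact_mod_cast Nat.choose_le_two_pow _ _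
    _ = _ := mul_comm _ _

theorem topCount_le_mass_supersets {s : Finset V} (hs : s.card ≤ m) (hm : m ≤ X.size) :
    X.topCount s ≤ X.mass {t ∈ X.facesCard m | s ⊆ t} := by
  refine le_trans (card_le_card ?_) (card_biUnion_le (s := {t ∈ X.facesCard m | s ⊆ t})
    (t := fun t => {F ∈ X.facesCard X.size | t ⊆ F}))
  intro F hF
  simp only [mem_filter, mem_biUnion, mem_facesCard] at hF ⊢
  obtain ⟨t, hst, htF, ht⟩ := exists_subsuperset_card_eq hF.2 hs (by omega)
  exact ⟨t, ⟨⟨X.down_closed hF.1.1 htF, ht⟩, hst⟩, hF.1, htF⟩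

/-- Minimality passes to subsets: `A + D` is covered by `A \ L` and `L + D`. -/
theorem mass_symmDiff_of_subset {A L D : Finset (Finset V)} (hL : L ⊆ A)
    (h : X.mass A ≤ X.mass (symmDiff A D)) : X.mass L ≤ X.mass (symmDiff L D) := by
  have h1 : X.mass (symmDiff A D) ≤ X.mass (A \ L) + X.mass (symmDiff L D) := by
    refine (mass_mono ?_).trans (mass_union_le _ _)
    intro t
    simp only [mem_symmDiff, mem_union, mem_sdiff]
    tauto
  have h2 : X.mass (A \ L) + X.mass L = X.mass A := sum_sdiff hL
  omega

/-- A locally minimal set of faces expands above every nonempty face. -/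
theorem IsDComplex.link_expansion (hX : X.IsDComplex d) {β : ℝ} (hβ : 0 < β) {k : ℕ}
    (hk : k + 1 ≤ d)
    (hlink : ∀ (s : Finset V) (hs : s ∈ X.faces), 1 ≤ s.card → s.card + 1 ≤ d →
      (X.link s hs).IsCoboundaryExpander β)
    {A : Finset (Finset V)} (hA : A ⊆ X.facesCard (k + 1))
    (hmin : ∀ s ∈ X.faces, s.Nonempty → ∀ G ⊆ X.facesCard k, (∀ p ∈ G, s ⊆ p) →
      X.mass A ≤ X.mass (symmDiff A (X.bd k G)))
    {s : Finset V} (hs : s ∈ X.faces) (hne : s.Nonempty) {L : Finset (Finset V)} (hLA : L ⊆ A)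
    (hsL : ∀ p ∈ L, s ⊆ p) :
    min β 1 / 2 ^ (d + 1) * X.mass L ≤ X.mass {t ∈ X.bd (k + 1) L | s ⊆ t} := by
  have hb0 : 0 < min β 1 := lt_min hβ one_pos
  have hL := hLA.trans hA
  rcases L.eq_empty_or_nonempty with rfl | ⟨p, hp⟩
  · simp only [mass, sum_empty, Nat.cast_zero, mul_zero]; positivity
  have hpc := (mem_facesCard.1 (hL hp)).2
  have hsp := card_le_card (hsL p hp)
  have h2 : (1 : ℝ) ≤ 2 ^ (d + 1) := one_le_pow₀ (by norm_num)
  -- If `s` is smaller than the members of `L`, expansion of its link applies. Otherwise `L = {s}`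
  -- is a `(-1)`-cochain of the link, to which `expB` does not apply; counting cofaces then gives
  -- the constant `1`, whence `min β 1`.
  rcases hsp.lt_or_eq with hlt | heq
  · obtain ⟨m, hm⟩ : ∃ m, k = s.card + m := ⟨k - s.card, by omega⟩
    have hd : s.card ≤ d := by omega
    have hl := hX.link hs hd
    have hls : (X.link s hs).size = d - s.card + 1 := hl.1
    subst hm
    set M := L.image (· \ s) with hM
    have hMl : X.lift s (s.card + (m + 1)) M = L := lift_image_sdiff hL hsL
    have hMf : M ⊆ (X.link s hs).facesCard (m + 1) := image_sdiff_subset hs hL hsL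
    have h := mass_mul_le_of_le_expB (m := m) hβ.le (hl.topCount_pos (FinComplex.empty_mem _))
      (by omega) (hlink s hs (card_pos.2 hne) (by omega) m (by omega)) hMf (fun G hG => ?_)
    · rw [hX.mass_link hs hd hMf, hX.mass_link hs hd (bd_subset M), hMl] at h
      have hb := lift_bd hs hMf
      rw [hMl] at hb
      rw [← add_assoc] at hb
      rw [← add_assoc, ← add_assoc, hb] at h
      rw [div_mul_eq_mul_div, div_le_iff₀ (by positivity), mul_comm (_ : ℝ) (2 ^ (d + 1))]
      calc min β 1 * (X.mass L : ℝ) ≤ β * X.mass L := by gcongr; exact min_le_left _ _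
        _ ≤ _ := h
        _ ≤ _ := by
          gcongr
          · norm_num
          · omega
    · have hsub : symmDiff M ((X.link s hs).bd m G) ⊆ (X.link s hs).facesCard (m + 1) := by
        intro t ht
        rcases mem_symmDiff.1 ht with ht | ht
        · exact hMf ht.1
        · exact bd_subset _ ht.1
      rw [hX.mass_link hs hd hMf, hX.mass_link hs hd hsub, lift_symmDiff, hMl, ← add_assoc,
        lift_bd hs hG, filter_bd_of_superset fun p hp => (mem_lift.1 hp).2.1]
      exact mass_symmDiff_of_subset hLA (hmin s hs hne _ (filter_subset _ _)
        fun p hp => (mem_lift.1 hp).2.1)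
  · have hL1 : ∀ q ∈ L, q = s := fun q hq => (eq_of_subset_of_card_le (hsL q hq) (by
      rw [heq, hpc, (mem_facesCard.1 (hL hq)).2])).symm
    have hLs : L = {s} := by
      ext q
      rw [mem_singleton]
      exact ⟨hL1 q, fun h => by rw [h, ← hL1 p hp]; exact hp⟩
    have hbd : {t ∈ X.bd (k + 1) L | s ⊆ t} = {t ∈ X.facesCard (k + 1 + 1) | s ⊆ t} := by
      ext t
      simp only [mem_filter, mem_bd, hLs, filter_singleton]
      constructor
      · exact fun h => ⟨h.1.1, h.2⟩
      · exact fun h => ⟨⟨h.1, by simp [h.2]⟩, h.2⟩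
    rw [hbd]
    have h3 := topCount_le_mass_supersets (X := X) (s := s) (m := k + 1 + 1) (by omega)
      (by rw [hX.1]; omega)
    have h4 : min β 1 / 2 ^ (d + 1) ≤ 1 := by
      rw [div_le_one (by positivity)]
      exact (min_le_right _ _).trans h2
    calc min β 1 / 2 ^ (d + 1) * (X.mass L : ℝ) ≤ 1 * X.mass L := by gcongr
      _ = X.topCount s := by simp [hLs, mass]
      _ ≤ _ := by exact_mod_cast h3

/-! ### Skeleton expansion in links. -/

theorem indicator_ne_zero {A : Finset (Finset V)} {s : X.Face n} :
    X.indicator n A s ≠ 0 ↔ s.1 ∈ A := by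
  simp [indicator]

theorem edgesWithin_ne_zero {A : X.Cochain 1} {e : X.Face 2} :
    X.edgesWithin A e ≠ 0 ↔ ∀ v : X.Face 1, v.1 ⊆ e.1 → A v ≠ 0 := by
  unfold edgesWithin
  split_ifs with h
  · simpa using h
  · simpa using h

theorem supp_edgesWithin {T : Finset (Finset V)} :
    supp (X.edgesWithin (X.indicator 1 T)) = X.around ∅ T := by
  ext e
  simp only [mem_supp, around, mem_filter, edgesWithin_ne_zero, indicator_ne_zero, card_empty,
    zero_add, empty_subset, true_and, forall_const]
  refine ⟨fun ⟨he, h⟩ => ⟨he, fun t hte ht => ?_⟩, fun ⟨he, h⟩ => ⟨he, fun v hv => ?_⟩⟩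
  · exact h ⟨t, mem_facesCard.2 ⟨X.down_closed (mem_facesCard.1 he).1 hte, ht⟩⟩ hte
  · exact h v.1 hv (mem_facesCard.1 v.2).2

/-- The norm of `T` is at most its density bound `η`, which turns the quadratic term into a linear
one. -/
theorem IsSkeletonExpander.mass_around_le {α : ℝ} (hα : 0 ≤ α) (h : X.IsSkeletonExpander α)
    (hX : 0 < X.topCount ∅) (hsz : 2 ≤ X.size) {T : Finset (Finset V)} (hT : T ⊆ X.facesCard 1)
    {η : ℝ} (hη : X.mass T ≤ η * X.topCount ∅) :
    X.mass (X.around ∅ T) ≤ 4 * 2 ^ X.size * (η + α) * X.mass T := by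
  have h1 := h (X.indicator 1 T)
  rw [wnorm_eq_mass, wnorm_eq_mass, supp_edgesWithin, supp_indicator hT] at h1
  have hc : (0 : ℝ) < X.size.choose 2 := by exact_mod_cast Nat.choose_pos hsz
  have hN : (0 : ℝ) < X.topCount ∅ := by exact_mod_cast hX
  have hη0 : 0 ≤ η := by
    by_contra hneg
    push Not at hneg
    have := mul_neg_of_neg_of_pos hneg hN
    have : (0 : ℝ) ≤ X.mass T := Nat.cast_nonneg _
    linarith
  have hD : (1 : ℝ) ≤ X.size.choose 1 := by
    rw [Nat.choose_one_right]; exact_mod_cast (by omega : 1 ≤ X.size)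
  set D : ℝ := ((X.size.choose 1 : ℕ) : ℝ)
  set N : ℝ := ((X.topCount ∅ : ℕ) : ℝ)
  set s : ℝ := ((X.mass T : ℕ) : ℝ)
  have hs0 : 0 ≤ s := Nat.cast_nonneg _
  rw [div_le_iff₀ (by positivity)] at h1
  have h2 : s / (D * N) ≤ s / N := by
    gcongr
    exact le_mul_of_one_le_left hN.le hD
  have h3 : s / N ≤ η := by rwa [div_le_iff₀ hN]
  have h4 : (s / (D * N)) ^ 2 + α * (s / (D * N)) ≤ (η + α) * (s / N) := by
    have h0 : 0 ≤ s / (D * N) := by positivity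
    have : s / (D * N) * (s / (D * N)) ≤ η * (s / N) := by
      gcongr
      exact h2.trans h3
    nlinarith [mul_le_mul_of_nonneg_left h2 hα]
  calc (X.mass (X.around ∅ T) : ℝ)
      ≤ 4 * ((s / (D * N)) ^ 2 + α * (s / (D * N))) * (X.size.choose 2 * N) := h1
    _ ≤ 4 * ((η + α) * (s / N)) * (2 ^ X.size * N) := by
        gcongr
        exact_mod_cast Nat.choose_le_two_pow _ _
    _ = _ := by field_simp

theorem IsDComplex.mass_around_le (hX : X.IsDComplex d) {α : ℝ} (hα : 0 ≤ α)
    {ρ : Finset V} (hρ : ρ ∈ X.faces) (hd : ρ.card + 1 ≤ d)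
    (h : (X.link ρ hρ).IsSkeletonExpander α) {T : Finset (Finset V)}
    (hT : T ⊆ X.facesCard (ρ.card + 1)) (hρT : ∀ t ∈ T, ρ ⊆ t) {η : ℝ}
    (hη : X.mass T ≤ η * X.topCount ρ) :
    X.mass (X.around ρ T) ≤ 4 * 2 ^ (d + 1) * (η + α) * X.mass T := by
  have hd' : ρ.card ≤ d := by omega
  have hl := hX.link hρ hd'
  have hls : (X.link ρ hρ).size = d - ρ.card + 1 := hl.1
  set M := T.image (· \ ρ) with hM
  have hMl : X.lift ρ (ρ.card + 1) M = T := lift_image_sdiff hT hρT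
  have hMf : M ⊆ (X.link ρ hρ).facesCard 1 := image_sdiff_subset hρ hT hρT
  have hN := hl.topCount_pos (FinComplex.empty_mem _)
  have hmT : (X.link ρ hρ).mass M = X.mass T := by rw [hX.mass_link hρ hd' hMf, hMl]
  have htop := hX.topCount_link_empty hρ hd'
  have h1 := h.mass_around_le hα hN (by omega) hMf (η := η) (by rwa [hmT, htop])
  have hsub : (X.link ρ hρ).around ∅ M ⊆ (X.link ρ hρ).facesCard 2 := by
    intro t ht
    simpa using (mem_filter.1 ht).1
  have h2 : X.around ρ T ⊆ X.lift ρ (ρ.card + 2) ((X.link ρ hρ).around ∅ M) := by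
    intro g hg
    rw [around, mem_filter] at hg
    obtain ⟨hgX, hρg, hg⟩ := hg
    refine mem_lift.2 ⟨hgX, hρg, ?_⟩
    rw [around, mem_filter]
    refine ⟨by simpa using sdiff_mem_facesCard_link hgX hρg, empty_subset _, ?_⟩
    intro t _ htg ht
    have hdis : Disjoint ρ t := (disjoint_sdiff (s := ρ) (t := g)).mono_right htg
    refine mem_image.2 ⟨ρ ∪ t, hg _ subset_union_left
      (union_subset hρg (htg.trans sdiff_subset)) ?_, union_sdiff_cancel_left hdis⟩
    rw [card_union_of_disjoint hdis, ht, card_empty]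
  have hη0 : 0 ≤ η := by
    by_contra hneg
    push Not at hneg
    have h5 : (0 : ℝ) < X.topCount ρ := by rw [← htop]; exact_mod_cast hN
    have := mul_neg_of_neg_of_pos hneg h5
    have : (0 : ℝ) ≤ X.mass T := Nat.cast_nonneg _
    linarith
  calc (X.mass (X.around ρ T) : ℝ) ≤ (X.link ρ hρ).mass ((X.link ρ hρ).around ∅ M) := by
        rw [hX.mass_link hρ hd' hsub]
        exact_mod_cast mass_mono h2
    _ ≤ _ := h1
    _ ≤ _ := by
        rw [hmT]
        gcongr
        · norm_num
        · omega

/-! ### Filling small cocycles. -/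

/-- Between a face `q` and a face `t ⊇ q` with two more vertices there are exactly two faces. -/
theorem bd_bd {G : Finset (Finset V)} (hG : G ⊆ X.facesCard n) :
    X.bd (n + 1) (X.bd n G) = ∅ := by
  refine eq_empty_of_forall_notMem fun t ht => ?_
  rw [mem_bd] at ht
  obtain ⟨ht, hodd⟩ := ht
  obtain ⟨htX, htc⟩ := mem_facesCard.1 ht
  refine Nat.not_even_iff_odd.2 hodd ?_
  have hbetween : ∀ q ∈ G, q ⊆ t → #{p ∈ X.facesCard (n + 1) | q ⊆ p ∧ p ⊆ t} = 2 := by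
    intro q hq hqt
    have hqc := (mem_facesCard.1 (hG hq)).2
    have : {p ∈ X.facesCard (n + 1) | q ⊆ p ∧ p ⊆ t} = (t \ q).image (insert · q) := by
      ext p
      simp only [mem_filter, mem_facesCard, mem_image, mem_sdiff]
      constructor
      · rintro ⟨⟨hp, hpc⟩, hqp, hpt⟩
        obtain ⟨x, hx, rfl⟩ := (covBy_iff_exists_insert (s := q) (t := p)).1
          (covBy_iff_card_sdiff_eq_one.2 ⟨hqp, by rw [card_sdiff_of_subset hqp]; omega⟩)
        exact ⟨x, ⟨hpt (mem_insert_self _ _), hx⟩, rfl⟩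
      · rintro ⟨x, ⟨hxt, hxq⟩, rfl⟩
        have hsub : insert x q ⊆ t := insert_subset hxt hqt
        exact ⟨⟨X.down_closed htX hsub, by rw [card_insert_of_notMem hxq, hqc]⟩,
          subset_insert _ _, hsub⟩
    rw [this, card_image_of_injOn, card_sdiff_of_subset hqt]
    · omega
    · intro x hx y hy hxy
      have hx := (mem_sdiff.1 hx).2
      have h : x ∈ insert y q := by
        have hxy : insert x q = insert y q := hxy
        rw [← hxy]; exact mem_insert_self _ _
      exact (mem_insert.1 h).resolve_right hx
  have hsum : ∑ p ∈ X.facesCard (n + 1) with p ⊆ t, #{q ∈ G | q ⊆ p} =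
      2 * #{q ∈ G | q ⊆ t} := by
    have h1 : ∀ p ∈ {p ∈ X.facesCard (n + 1) | p ⊆ t}, #{q ∈ G | q ⊆ p} =
        #{q ∈ {q ∈ G | q ⊆ t} | q ⊆ p} := by
      intro p hp
      congr 1
      ext q
      simp only [mem_filter]
      exact ⟨fun h => ⟨⟨h.1, h.2.trans (mem_filter.1 hp).2⟩, h.2⟩, fun h => ⟨h.1.1, h.2⟩⟩
    rw [sum_congr rfl h1]
    refine (sum_card_bipartiteAbove_eq_sum_card_bipartiteBelow (fun p q : Finset V => q ⊆ p)).trans ?_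
    rw [mul_comm, ← smul_eq_mul, ← sum_const]
    refine sum_congr rfl fun q hq => ?_
    rw [mem_filter] at hq
    rw [← hbetween q hq.1 hq.2]
    congr 1
    ext p
    simp only [bipartiteBelow, mem_filter]
    tauto
  have hcast : ((#{p ∈ X.bd n G | p ⊆ t} : ℕ) : ZMod 2) =
      ((∑ p ∈ X.facesCard (n + 1) with p ⊆ t, #{q ∈ G | q ⊆ p} : ℕ) : ZMod 2) := by
    have : {p ∈ X.bd n G | p ⊆ t} =
        {p ∈ {p ∈ X.facesCard (n + 1) | p ⊆ t} | Odd #{q ∈ G | q ⊆ p}} := by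
      ext p; simp only [mem_filter, mem_bd]; tauto
    rw [this, card_filter, Nat.cast_sum, Nat.cast_sum]
    refine sum_congr rfl fun p _ => ?_
    split_ifs with h
    · rw [Nat.cast_one, (ZMod.natCast_eq_one_iff_odd).2 h]
    · rw [Nat.cast_zero, (ZMod.natCast_eq_zero_iff_even).2 (Nat.not_odd_iff_even.1 h)]
  rw [← ZMod.natCast_eq_zero_iff_even, hcast, hsum]
  exact (ZMod.natCast_eq_zero_iff_even).2 (even_two_mul _)

theorem symmDiff_subset_facesCard {A B : Finset (Finset V)} (hA : A ⊆ X.facesCard n)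
    (hB : B ⊆ X.facesCard n) : symmDiff A B ⊆ X.facesCard n := fun t ht => by
  rcases mem_symmDiff.1 ht with ht | ht
  · exact hA ht.1
  · exact hB ht.1

theorem mass_symmDiff_le (A B : Finset (Finset V)) :
    X.mass (symmDiff A B) ≤ X.mass A + X.mass B :=
  (mass_mono symmDiff_le_sup).trans (mass_union_le A B)

theorem bd_empty : X.bd n ∅ = ∅ := by
  ext t; simp [mem_bd]

/-- If small locally minimal cocycles vanish, a small cocycle is the coboundary of a set which is
not much larger. -/
theorem exists_bd_eq {k : ℕ} {μ c : ℝ} (hc : 0 ≤ c)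
    (hcX : ∀ s ∈ X.faces, s.Nonempty → c * (2 ^ X.size * X.topCount s) < 1)
    (hX : ∀ A ⊆ X.facesCard (k + 1), X.bd (k + 1) A = ∅ →
      (∀ s ∈ X.faces, s.Nonempty → ∀ G ⊆ X.facesCard k, (∀ p ∈ G, s ⊆ p) →
        X.mass A ≤ X.mass (symmDiff A (X.bd k G))) → X.mass A < μ * X.topCount ∅ → A = ∅)
    {A : Finset (Finset V)} (hA : A ⊆ X.facesCard (k + 1)) (hbd : X.bd (k + 1) A = ∅)
    (hsmall : X.mass A < μ * X.topCount ∅) :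
    ∃ G ⊆ X.facesCard k, X.bd k G = A ∧ c * X.mass G ≤ X.mass A := by
  -- The penalty `c * X.mass G` keeps the filling small, at the price of minimality only up to an
  -- error.
  obtain ⟨G, hG, hGmin⟩ := exists_min_image (X.facesCard k).powerset
    (fun G => (X.mass (symmDiff A (X.bd k G)) : ℝ) + c * X.mass G) ⟨∅, by simp⟩
  rw [mem_powerset] at hG
  have hle : (X.mass (symmDiff A (X.bd k G)) : ℝ) + c * X.mass G ≤ X.mass A := by
    have := hGmin ∅ (by simp)
    rw [bd_empty, ← bot_eq_empty, symmDiff_bot] at this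
    simpa [mass] using this
  have hGnn : 0 ≤ c * X.mass G := by positivity
  have hempty : symmDiff A (X.bd k G) = ∅ := by
    refine hX _ (symmDiff_subset_facesCard hA (bd_subset G)) ?_ ?_ ?_
    · rw [bd_symmDiff, hbd, bd_bd hG, symmDiff_self]; rfl
    · intro s hs hne H hH hsH
      have h1 := hGmin (symmDiff G H) (mem_powerset.2 (symmDiff_subset_facesCard hG hH))
      rw [bd_symmDiff, ← symmDiff_assoc] at h1
      have h2 : X.mass H ≤ 2 ^ X.size * X.topCount s :=
        (mass_mono fun p hp => mem_filter.2 ⟨hH hp, hsH p hp⟩).trans (X.mass_supersets_le s k)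
      have h3 : (X.mass (symmDiff G H) : ℝ) ≤ X.mass G + 2 ^ X.size * X.topCount s := by
        exact_mod_cast (mass_symmDiff_le G H).trans (Nat.add_le_add_left h2 _)
      have h4 := hcX s hs hne
      have h5 := mul_le_mul_of_nonneg_left h3 hc
      -- A cochain `H` above a nonempty face changes the penalty by less than `1`. Masses are
      -- integers, so minimality up to this error is exact.
      rw [← Nat.lt_add_one_iff]
      have : (X.mass (symmDiff A (X.bd k G)) : ℝ) <
          X.mass (symmDiff (symmDiff A (X.bd k G)) (X.bd k H)) + 1 := by linarith
      exact_mod_cast this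
    · linarith
  refine ⟨G, hG, ?_, ?_⟩
  · exact (symmDiff_eq_bot.1 hempty).symm
  · linarith [(Nat.cast_nonneg (X.mass (symmDiff A (X.bd k G))) : (0 : ℝ) ≤ _)]

/-- The constants depend on `d` and `β` only; the degree bound plays no part up to this point. -/
theorem exists_forall_small_eq_empty (d : ℕ) {β : ℝ} (hβ : 0 < β) :
    ∃ μ α : ℝ, 0 < μ ∧ 0 < α ∧ ∀ (V : Type*) (X : FinComplex V), X.IsDComplex d →
      (∀ (s : Finset V) (hs : s ∈ X.faces), 1 ≤ s.card → s.card + 1 ≤ d →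
        (X.link s hs).IsCoboundaryExpander β) →
      (∀ (s : Finset V) (hs : s ∈ X.faces), s.card + 1 ≤ d →
        (X.link s hs).IsSkeletonExpander α) →
      ∀ k, k + 1 ≤ d → ∀ A ⊆ X.facesCard (k + 1), X.bd (k + 1) A = ∅ →
      (∀ s ∈ X.faces, s.Nonempty → ∀ G ⊆ X.facesCard k, (∀ p ∈ G, s ⊆ p) →
        X.mass A ≤ X.mass (symmDiff A (X.bd k G))) → X.mass A < μ * X.topCount ∅ → A = ∅ := by
  set b : ℝ := min β 1 / 2 ^ (d + 1) with hb
  have hb0 : 0 < b := by have := lt_min hβ one_pos; positivity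
  set M : ℝ := (d + 1) * (2 * (4 * 2 ^ (d + 1)) * (2 ^ (d + 1)) ^ (d + 3)) with hM
  have hM0 : 0 < M := by positivity
  -- This gives `M * δ ≤ b / 2 < b`, the smallness demanded by `IsDComplex.eq_empty_of_small`.
  set δ : ℝ := min 1 (b / (2 * M)) with hδ
  have hδ0 : 0 < δ := lt_min one_pos (by positivity)
  refine ⟨δ ^ 2 ^ d / (2 ^ (d + 1)) ^ d, δ ^ 2 ^ d, by positivity, by positivity, ?_⟩
  intro V X hX hlink hskel k hk A hA hbd hmin hsmall
  refine hX.eq_empty_of_small (K := 4 * 2 ^ (d + 1)) hδ0 (min_le_left _ _) (by positivity) hk hA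
    hbd (fun ρ hρ hd T hT hρT η hη => ?_) (fun s hs hne L hL hsL => ?_) le_rfl ?_ ?_ (β := b)
  · exact hX.mass_around_le (by positivity) hρ hd (hskel ρ hρ hd) hT hρT hη
  · exact hX.link_expansion hβ hk hlink hA hmin hs hne hL hsL
  · have h1 : δ ≤ b / (2 * M) := min_le_right _ _
    rw [le_div_iff₀ (by positivity)] at h1
    linarith
  · rw [div_mul_eq_mul_div, lt_div_iff₀ (by positivity)] at hsmall
    linarith

theorem IsBoundedDegree.topCount_le {Q : ℕ} (hQ : X.IsBoundedDegree Q) (hX : X.IsDComplex d)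
    (hd : 1 ≤ d) {s : Finset V} (hs : s ∈ X.faces) (hne : s.Nonempty) : X.topCount s ≤ Q := by
  obtain ⟨v, hv⟩ := hne
  have hvX := X.down_closed hs (singleton_subset_iff.2 hv)
  refine (topCount_anti (singleton_subset_iff.2 hv)).trans (le_trans ?_ (hQ v hvX))
  rw [← hX.topCount_link_empty hvX (by simpa using hd), topCount_empty]
  exact card_le_card (filter_subset _ _)

/-- The coboundary of `A` is a cocycle one dimension higher, which is why `k + 2 ≤ d` is needed. If
it is small, its filling serves as `B`; if it is large, `A` itself does, since the total mass is
bounded. -/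
theorem exists_bd_eq_bd {k Q : ℕ} (hX : X.IsDComplex d) {μ : ℝ}
    (hμ : 0 < μ)
    (h : ∀ k, k + 1 ≤ d → ∀ A ⊆ X.facesCard (k + 1), X.bd (k + 1) A = ∅ →
      X.mass A < μ * X.topCount ∅ →
      ∃ G ⊆ X.facesCard k, X.bd k G = A ∧ 1 / (2 ^ (d + 1) * Q + 1) * (X.mass G : ℝ) ≤ X.mass A)
    (hk : k + 2 ≤ d) {A : Finset (Finset V)} (hA : A ⊆ X.facesCard (k + 1)) :
    ∃ B ⊆ X.facesCard (k + 1), X.bd (k + 1) B = X.bd (k + 1) A ∧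
      min (μ / 2 ^ (d + 1)) (1 / (2 ^ (d + 1) * Q + 1)) * (X.mass B : ℝ) ≤
        X.mass (X.bd (k + 1) A) := by
  rcases lt_or_ge (X.mass (X.bd (k + 1) A) : ℝ) (μ * X.topCount ∅) with hlt | hge
  · obtain ⟨G, hG, hGA, hle⟩ := h (k + 1) hk _ (bd_subset A) (bd_bd hA) hlt
    exact ⟨G, hG, hGA, (mul_le_mul_of_nonneg_right (min_le_right _ _) (Nat.cast_nonneg _)).trans hle⟩
  · refine ⟨A, hA, rfl, ?_⟩
    have h1 : (X.mass A : ℝ) ≤ 2 ^ (d + 1) * X.topCount ∅ := by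
      have := (mass_mono hA).trans (X.mass_facesCard_le (k + 1))
      rw [hX.1] at this
      exact_mod_cast this
    calc _ ≤ μ / 2 ^ (d + 1) * (2 ^ (d + 1) * X.topCount ∅ : ℝ) := by
          gcongr; exact min_le_left _ _
      _ = μ * X.topCount ∅ := by field_simp
      _ ≤ _ := hge

/-! ### Return to `expZ`, `syst` and normalized weights. -/

/-- Sets with equal coboundary differ by a cocycle, so the norm of `B` bounds the distance from `A`
to the cocycles. -/
theorem le_expZ {Y : FinComplex V} {k : ℕ} {ε : ℝ} (hε : 0 ≤ ε)
    (hpos : ∀ s ∈ Y.facesCard (k + 1), 0 < Y.weight s)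
    (h : ∀ A ⊆ Y.facesCard (k + 1), ∃ B ⊆ Y.facesCard (k + 1), Y.bd (k + 1) B = Y.bd (k + 1) A ∧
      ε * ∑ s ∈ B, Y.weight s ≤ ∑ s ∈ Y.bd (k + 1) A, Y.weight s) :
    (ε : EReal) ≤ Y.expZ k := by
  refine le_iInf₂ fun f hf => EReal.coe_le_coe_iff.2 ?_
  have hdouble : ∀ g : Y.Cochain (k + 1), g + g = 0 := fun g => by
    funext s; exact CharTwo.add_self_eq_zero _
  -- Positivity is essential: a zero denominator would make the real quotient `0`. The infimum is
  -- over a finite set, hence attained.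
  have hinf : 0 < ⨅ z : Y.cocycles k, Y.wnorm (f + z.1) := by
    obtain ⟨z, hz⟩ := exists_eq_ciInf_of_finite (f := fun z : Y.cocycles k => Y.wnorm (f + z.1))
    rw [← hz, wnorm_eq_sum]
    refine sum_pos (fun s hs => hpos s (supp_subset _ hs)) (nonempty_iff_ne_empty.2 fun h0 => ?_)
    refine hf ?_
    have h1 : f + z.1 = 0 := by
      apply supp_injective
      rw [h0]; ext s; simp [mem_supp]
    rw [eq_neg_of_add_eq_zero_left h1]
    exact neg_mem z.2
  rw [le_div_iff₀ hinf]
  obtain ⟨B, hB, hBA, hle⟩ := h (supp f) (supp_subset f)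
  set g := Y.indicator (k + 1) B with hg
  have hgz : Y.cobd (k + 1) g = Y.cobd (k + 1) f := by
    apply supp_injective
    rw [supp_cobd, supp_cobd, supp_indicator hB, hBA]
  have hz : f + g ∈ Y.cocycles k := by
    rw [cocycles, LinearMap.mem_ker, map_add, hgz]
    funext s; exact CharTwo.add_self_eq_zero _
  have h1 : ⨅ z : Y.cocycles k, Y.wnorm (f + z.1) ≤ Y.wnorm g := by
    refine (ciInf_le (Set.finite_range _).bddBelow ⟨f + g, hz⟩).trans_eq ?_
    rw [← add_assoc, hdouble, zero_add]
  calc ε * ⨅ z : Y.cocycles k, Y.wnorm (f + z.1) ≤ ε * Y.wnorm g := by gcongr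
    _ ≤ _ := by
      rw [wnorm_eq_sum, wnorm_eq_sum, supp_cobd, supp_indicator hB]
      exact hle

theorem le_syst {Y : FinComplex V} {k : ℕ} {μ : ℝ}
    (h : ∀ A ⊆ Y.facesCard (k + 1), Y.bd (k + 1) A = ∅ → ∑ s ∈ A, Y.weight s < μ →
      ∃ G ⊆ Y.facesCard k, Y.bd k G = A) : (μ : EReal) ≤ Y.syst k := by
  refine le_iInf₂ fun z hz => EReal.coe_le_coe_iff.2 ?_
  by_contra hlt
  rw [not_le, wnorm_eq_sum] at hlt
  obtain ⟨G, hG, hGz⟩ := h (supp z) (supp_subset z) (by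
    rw [← supp_cobd, LinearMap.mem_ker.1 hz.1]; ext s; simp [mem_supp]) hlt
  refine hz.2 ⟨Y.indicator k G, supp_injective ?_⟩
  rw [supp_cobd, supp_indicator hG, hGz]

theorem IsDComplex.sum_weight_le (hX : X.IsDComplex d) (hn : n ≤ d + 1) {A : Finset (Finset V)}
    (hA : A ⊆ X.facesCard n) :
    ∑ s ∈ A, X.weight s ≤ X.mass A / X.topCount ∅ ∧
      X.mass A / (2 ^ (d + 1) * X.topCount ∅) ≤ ∑ s ∈ A, X.weight s := by
  have h := wnorm_eq_mass (X.indicator n A)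
  rw [wnorm_eq_sum, supp_indicator hA, hX.1] at h
  rw [h]
  have hN : (0 : ℝ) < X.topCount ∅ := by exact_mod_cast hX.topCount_pos X.empty_mem
  have hc : (1 : ℝ) ≤ (d + 1).choose n := by exact_mod_cast Nat.choose_pos hn
  constructor
  · gcongr
    exact le_mul_of_one_le_left hN.le hc
  · gcongr
    exact_mod_cast Nat.choose_le_two_pow _ _

theorem IsDComplex.weight_pos (hX : X.IsDComplex d) {s : Finset V} (hs : s ∈ X.faces) :
    0 < X.weight s := by
  have hsz := card_le_size hs
  have h1 : 0 < X.topCount s := hX.topCount_pos hs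
  have h2 : 0 < #(X.facesCard X.size) := by
    rw [← topCount_empty]; exact hX.topCount_pos X.empty_mem
  have h3 : 0 < X.size.choose s.card := Nat.choose_pos hsz
  have h4 : X.weight s = X.topCount s / (X.size.choose s.card * #(X.facesCard X.size)) := rfl
  rw [h4]
  positivity

/-! ### Comparison of norms on the skeleton. -/

section Skeleton

theorem facesCard_skeleton (h : n ≤ m + 1) : (X.skeleton m).facesCard n = X.facesCard n := by
  ext s
  simp only [mem_facesCard, skeleton, mem_filter]
  exact ⟨fun hs => ⟨hs.1.1, hs.2⟩, fun hs => ⟨⟨hs.1, by omega⟩, hs.2⟩⟩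

theorem bd_skeleton (h : n ≤ m) (A : Finset (Finset V)) : (X.skeleton m).bd n A = X.bd n A := by
  rw [bd, bd, facesCard_skeleton (by omega)]

theorem IsDComplex.size_skeleton (hX : X.IsDComplex d) (h : m ≤ d) :
    (X.skeleton m).size = m + 1 := by
  refine le_antisymm (Finset.sup_le fun s hs => (mem_filter.1 hs).2) ?_
  obtain ⟨t, ht, _, htc⟩ := hX.2 ∅ X.empty_mem
  obtain ⟨u, hut, huc⟩ := exists_subset_card_eq (s := t) (n := m + 1) (by omega)
  rw [← huc]
  exact card_le_size (mem_filter.2 ⟨X.down_closed ht hut, huc.le⟩)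

/-- A top face containing `s` has one facet above `s` for each of its vertices outside `s`. -/
theorem IsDComplex.mass_ridges (hX : X.IsDComplex d) {s : Finset V} (hs : s.card ≤ d) :
    X.mass {G ∈ X.facesCard d | s ⊆ G} = (d + 1 - s.card) * X.topCount s := by
  have hsz : X.size = d + 1 := hX.1
  have h1 : X.mass {G ∈ X.facesCard d | s ⊆ G} =
      ∑ F ∈ X.facesCard X.size, #{G ∈ {G ∈ X.facesCard d | s ⊆ G} | G ⊆ F} := by
    unfold mass topCount
    simp only [card_filter _ (X.facesCard X.size), card_filter _ (filter _ _)]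
    exact sum_comm
  rw [h1, topCount, mul_comm, ← smul_eq_mul, ← sum_const, sum_filter]
  refine sum_congr rfl fun F hF => ?_
  obtain ⟨hFX, hFc⟩ := mem_facesCard.1 hF
  split_ifs with hsF
  · have : {G ∈ {G ∈ X.facesCard d | s ⊆ G} | G ⊆ F} = (F \ s).image F.erase := by
      ext G
      simp only [mem_filter, mem_facesCard, mem_image, mem_sdiff]
      constructor
      · rintro ⟨⟨⟨_, hGc⟩, hsG⟩, hGF⟩
        obtain ⟨x, hx, rfl⟩ := (covBy_iff_exists_insert (s := G) (t := F)).1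
          (covBy_iff_card_sdiff_eq_one.2 ⟨hGF, by rw [card_sdiff_of_subset hGF]; omega⟩)
        exact ⟨x, ⟨mem_insert_self _ _, fun h => hx (hsG h)⟩, erase_insert hx⟩
      · rintro ⟨x, ⟨hxF, hxs⟩, rfl⟩
        have := card_erase_add_one hxF
        exact ⟨⟨⟨X.down_closed hFX (erase_subset _ _), by omega⟩, subset_erase.2 ⟨hsF, hxs⟩⟩,
          erase_subset _ _⟩
    rw [this, card_image_of_injOn, card_sdiff_of_subset hsF]
    · omega
    · exact (erase_injOn F).mono (by simp)
  · refine card_eq_zero.2 (filter_eq_empty_iff.2 fun G hG hGF => hsF ?_)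
    exact (mem_filter.1 hG).2.trans hGF

/-- Each ridge lies in between `1` and `Q` top faces, so `IsDComplex.mass_ridges` compares ridge
counts with top counts, both for `s` and for the empty face. -/
theorem IsDComplex.weight_skeleton (hX : X.IsDComplex d) (hd : 1 ≤ d) {Q : ℕ}
    (hQ : X.IsBoundedDegree Q) {s : Finset V} (hs : s ∈ X.faces) (hsd : s.card ≤ d) :
    X.weight s ≤ Q * (X.skeleton (d - 1)).weight s ∧
      (X.skeleton (d - 1)).weight s ≤ Q * X.weight s := by
  have hsz : X.size = d + 1 := hX.1
  have hYs : (X.skeleton (d - 1)).size = d := by rw [hX.size_skeleton (by omega)]; omega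
  have hYf : (X.skeleton (d - 1)).facesCard d = X.facesCard d := facesCard_skeleton (by omega)
  set r : Finset V → ℕ := fun s => #{G ∈ X.facesCard d | s ⊆ G} with hr
  have hwY : (X.skeleton (d - 1)).weight s = r s / (d.choose s.card * r ∅) := by
    simp [weight, hYs, hYf, hr]
  have hwX : X.weight s = X.topCount s / ((d + 1).choose s.card * X.topCount ∅) := by
    rw [topCount_empty, ← hsz]; rfl
  have hbounds : ∀ s : Finset V, s.card ≤ d → r s ≤ (d + 1 - s.card) * X.topCount s ∧
      (d + 1 - s.card) * X.topCount s ≤ Q * r s := by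
    intro s hs
    rw [← hX.mass_ridges hs, mass, mul_comm Q]
    have hG : ∀ G ∈ {G ∈ X.facesCard d | s ⊆ G}, 1 ≤ X.topCount G ∧ X.topCount G ≤ Q := by
      intro G hG
      obtain ⟨hGX, hGc⟩ := mem_facesCard.1 (mem_filter.1 hG).1
      exact ⟨hX.topCount_pos hGX, hQ.topCount_le hX hd hGX (card_pos.1 (by omega))⟩
    constructor
    · simpa using card_nsmul_le_sum _ X.topCount 1 fun G h => (hG G h).1
    · simpa using sum_le_card_nsmul _ X.topCount Q fun G h => (hG G h).2
  have h1 := hbounds s hsd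
  have h0 := hbounds ∅ (by simp)
  rw [card_empty, Nat.sub_zero] at h0
  have hchoose := Nat.choose_mul_succ_eq d s.card
  have hN := hX.topCount_pos X.empty_mem
  have hN' := hX.topCount_pos hs
  have hr0 : 0 < r ∅ := by
    by_contra h
    have : r ∅ = 0 := by omega
    rw [this, mul_zero] at h0
    have := Nat.mul_pos (Nat.add_one_pos d) hN
    omega
  have hc1 := Nat.choose_pos hsd
  have hc2 : 0 < (d + 1).choose s.card := Nat.choose_pos (by omega)
  have he : 0 < d + 1 - s.card := by omega
  generalize (d + 1 - s.card) = e at *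
  generalize d.choose s.card = a at *
  generalize (d + 1).choose s.card = b at *
  generalize X.topCount s = c at *
  generalize X.topCount ∅ = N at *
  generalize r s = u at *
  generalize r ∅ = w at *
  -- The identity `a * (d + 1) = b * e` between binomials absorbs the ridge multiplicities, so that
  -- only factors `Q` remain.
  have hkey : (c : ℝ) / (b * N) = (e * c) / (a * ((d + 1) * N)) := by
    have : (a : ℝ) * (d + 1) = b * e := by exact_mod_cast hchoose
    rw [← mul_assoc (a : ℝ), this]
    field_simp
  have h1a : (u : ℝ) ≤ e * c := by exact_mod_cast h1.1
  have h1b : (e : ℝ) * c ≤ Q * u := by exact_mod_cast h1.2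
  have h0a : (w : ℝ) ≤ (d + 1) * N := by exact_mod_cast h0.1
  have h0b : ((d : ℝ) + 1) * N ≤ Q * w := by exact_mod_cast h0.2
  rw [hwX, hwY, hkey]
  constructor
  · rw [← mul_div_assoc]
    gcongr
  · rw [← mul_div_assoc, div_le_div_iff₀ (by positivity) (by positivity)]
    calc (u : ℝ) * (a * ((d + 1) * N)) ≤ (e * c) * (a * (Q * w)) := by gcongr
      _ = _ := by ring

end Skeleton

end FinComplex

/-! ### Assembly of the constants. -/

open FinComplex

theorem mainTheorem2 (d : ℕ) (β : ℝ) (hβ : 0 < β) :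
    ∃ μ α : ℝ, 0 < μ ∧ 0 < α ∧ ∀ Q : ℕ, ∃ ε : ℝ, 0 < ε ∧
      ∀ (V : Type*) (X : FinComplex V), X.IsDComplex d → X.IsBoundedDegree Q →
        (∀ (σ : Finset V) (hσ : σ ∈ X.faces), 1 ≤ σ.card → σ.card + 1 ≤ d →
          (X.link σ hσ).IsCoboundaryExpander β) →
        (∀ (σ : Finset V) (hσ : σ ∈ X.faces), σ.card + 1 ≤ d →
          (X.link σ hσ).IsSkeletonExpander α) →
        (∀ k : ℕ, k + 2 ≤ d → (ε : EReal) ≤ X.expZ k) ∧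
        (∀ r : ℕ, r + 1 ≤ d → (μ : EReal) ≤ X.syst r) ∧
        (X.skeleton (d - 1)).IsCosystolicExpander ε (μ / Q) := by
  obtain ⟨μ₀, α, hμ₀, hα, hvanish⟩ := exists_forall_small_eq_empty d hβ
  refine ⟨μ₀ / 2 ^ (d + 1), α, by positivity, hα, fun Q => ?_⟩
  set ε₀ : ℝ := min (μ₀ / 2 ^ (d + 1)) (1 / (2 ^ (d + 1) * Q + 1)) with hε₀
  have hε₀0 : 0 < ε₀ := lt_min (by positivity) (by positivity)
  -- The power of two pays for the binomial normalizations, and `(Q + 1) ^ 2` for changing to the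
  -- skeleton's norm on both sides; `Q + 1` keeps the quotient positive when `Q = 0`.
  set ε : ℝ := ε₀ / (2 ^ (d + 1) * (Q + 1) ^ 2) with hε
  have hε0 : 0 < ε := by positivity
  refine ⟨ε, hε0, fun V X hX hQ hlink hskel => ?_⟩
  have hN : (0 : ℝ) < X.topCount ∅ := by exact_mod_cast hX.topCount_pos X.empty_mem
  have hfill : ∀ k, k + 1 ≤ d → ∀ A ⊆ X.facesCard (k + 1), X.bd (k + 1) A = ∅ →
      X.mass A < μ₀ * X.topCount ∅ → ∃ G ⊆ X.facesCard k, X.bd k G = A ∧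
        1 / (2 ^ (d + 1) * Q + 1) * (X.mass G : ℝ) ≤ X.mass A := by
    intro k hk A hA hbd hsmall
    refine exists_bd_eq (by positivity) (fun s hs hne => ?_)
      (hvanish V X hX hlink hskel k hk) hA hbd hsmall
    have h1 : (X.topCount s : ℝ) ≤ Q := by
      exact_mod_cast hQ.topCount_le hX (by omega) hs hne
    rw [hX.1, div_mul_eq_mul_div, one_mul, div_lt_one (by positivity)]
    have := mul_le_mul_of_nonneg_left h1 (by positivity : (0 : ℝ) ≤ 2 ^ (d + 1))
    linarith
  have hexpand : ∀ k, k + 2 ≤ d → ∀ A ⊆ X.facesCard (k + 1), ∃ B ⊆ X.facesCard (k + 1),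
      X.bd (k + 1) B = X.bd (k + 1) A ∧
      ε * (Q + 1) ^ 2 * ∑ s ∈ B, X.weight s ≤ ∑ s ∈ X.bd (k + 1) A, X.weight s := by
    intro k hk A hA
    obtain ⟨B, hB, hBA, hle⟩ := exists_bd_eq_bd hX hμ₀ hfill hk hA
    refine ⟨B, hB, hBA, ?_⟩
    have h1 := (hX.sum_weight_le (by omega) hB).1
    have h2 := (hX.sum_weight_le (n := k + 1 + 1) (by omega) (bd_subset A)).2
    calc ε * (Q + 1) ^ 2 * ∑ s ∈ B, X.weight s
        ≤ ε * (Q + 1) ^ 2 * (X.mass B / X.topCount ∅) := by gcongr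
      _ = ε₀ * X.mass B / (2 ^ (d + 1) * X.topCount ∅) := by rw [hε]; field_simp
      _ ≤ X.mass (X.bd (k + 1) A) / (2 ^ (d + 1) * X.topCount ∅) := by gcongr
      _ ≤ _ := h2
  have hsyst : ∀ k, k + 1 ≤ d → ∀ A ⊆ X.facesCard (k + 1), X.bd (k + 1) A = ∅ →
      ∑ s ∈ A, X.weight s < μ₀ / 2 ^ (d + 1) → ∃ G ⊆ X.facesCard k, X.bd k G = A := by
    intro k hk A hA hbd hlt
    have h2 := ((hX.sum_weight_le (by omega) hA).2).trans_lt hlt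
    obtain ⟨G, hG, hGA, _⟩ := hfill k hk A hA hbd (by
      rw [div_lt_div_iff₀ (by positivity) (by positivity)] at h2
      refine lt_of_mul_lt_mul_right (h2.trans_eq ?_) (by positivity : (0 : ℝ) ≤ 2 ^ (d + 1))
      ring)
    exact ⟨G, hG, hGA⟩
  refine ⟨fun k hk => ?_, fun r hr => le_syst (hsyst r hr), fun k hk => ?_⟩
  · refine le_expZ hε0.le (fun s hs => hX.weight_pos (mem_facesCard.1 hs).1) fun A hA => ?_
    obtain ⟨B, hB, hBA, hle⟩ := hexpand k hk A hA
    refine ⟨B, hB, hBA, le_trans ?_ hle⟩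
    gcongr
    · exact Finset.sum_nonneg fun s _ => X.weight_nonneg s
    · refine le_mul_of_one_le_right hε0.le (one_le_pow₀ ?_)
      linarith [(Nat.cast_nonneg Q : (0 : ℝ) ≤ Q)]
  -- For `d = 0` truncated subtraction gives the `0`-skeleton, in which there is no dimension `k` to
  -- check.
  rcases Nat.eq_zero_or_pos d with rfl | hd
  · rw [hX.size_skeleton (by omega)] at hk
    omega
  rw [hX.size_skeleton (by omega)] at hk
  set Y := X.skeleton (d - 1) with hY
  have hface : ∀ n ≤ d, Y.facesCard n = X.facesCard n := fun n hn =>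
    facesCard_skeleton (by omega)
  have hbdY : ∀ n < d, ∀ A, Y.bd n A = X.bd n A := fun n hn A => bd_skeleton (by omega) A
  have hw : ∀ n ≤ d, ∀ s ∈ X.facesCard n,
      X.weight s ≤ Q * Y.weight s ∧ Y.weight s ≤ Q * X.weight s := by
    intro n hn s hs
    rw [mem_facesCard] at hs
    exact hX.weight_skeleton hd hQ hs.1 (by omega)
  have hsumXY : ∀ n ≤ d, ∀ A ⊆ X.facesCard n,
      ∑ s ∈ A, X.weight s ≤ Q * ∑ s ∈ A, Y.weight s := by
    intro n hn A hA
    rw [Finset.mul_sum]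
    exact Finset.sum_le_sum fun s hs => (hw n hn s (hA hs)).1
  have hsumYX : ∀ n ≤ d, ∀ A ⊆ X.facesCard n,
      ∑ s ∈ A, Y.weight s ≤ Q * ∑ s ∈ A, X.weight s := by
    intro n hn A hA
    rw [Finset.mul_sum]
    exact Finset.sum_le_sum fun s hs => (hw n hn s (hA hs)).2
  have hQ0 : (0 : ℝ) < Q := by
    have h1 := (hw 0 (by omega) ∅ (mem_facesCard.2 ⟨X.empty_mem, rfl⟩)).1
    by_contra hneg
    have h2 : (Q : ℝ) = 0 := le_antisymm (not_lt.1 hneg) (Nat.cast_nonneg _)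
    rw [h2, zero_mul] at h1
    exact absurd (hX.weight_pos X.empty_mem) (not_lt.2 h1)
  constructor
  · refine le_expZ hε0.le (fun s hs => ?_) fun A hA => ?_
    · rw [hface _ (by omega)] at hs
      have h1 := (hw (k + 1) (by omega) s hs).1
      have h2 := hX.weight_pos (mem_facesCard.1 hs).1
      exact pos_of_mul_pos_right (h2.trans_le h1) hQ0.le
    · rw [hface _ (by omega)] at hA
      obtain ⟨B, hB, hBA, hle⟩ := hexpand k (by omega) A hA
      rw [hface _ (by omega)]
      refine ⟨B, hB, by rw [hbdY _ (by omega), hbdY _ (by omega), hBA], ?_⟩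
      rw [hbdY _ (by omega)]
      have h1 := hsumYX (k + 1) (by omega) B hB
      have h2 := hsumXY (k + 1 + 1) (by omega) _ (bd_subset A)
      have h3 : 0 ≤ ∑ s ∈ B, X.weight s := Finset.sum_nonneg fun s _ => X.weight_nonneg s
      refine le_of_mul_le_mul_left ?_ hQ0
      calc (Q : ℝ) * (ε * ∑ s ∈ B, Y.weight s) ≤ Q * (ε * (Q * ∑ s ∈ B, X.weight s)) := by gcongr
        _ = ε * Q ^ 2 * ∑ s ∈ B, X.weight s := by ring
        _ ≤ ε * (Q + 1) ^ 2 * ∑ s ∈ B, X.weight s := by gcongr; linarith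
        _ ≤ _ := hle.trans h2
  · refine le_syst fun A hA hbd hlt => ?_
    rw [hface _ (by omega)] at hA
    rw [hbdY _ (by omega)] at hbd
    rw [lt_div_iff₀ hQ0] at hlt
    obtain ⟨G, hG, hGA⟩ := hsyst k (by omega) A hA hbd
      ((hsumXY (k + 1) (by omega) A hA).trans_lt (by linarith))
    exact ⟨G, by rwa [hface _ (by omega)], by rw [hbdY _ (by omega), hGA]⟩
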